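/- Conventions. Let $X$ be a metric space. A geodesic with endpoints $a,b$ is an isometric image of $[0,d(a,b)]$; $X$ is a geodesic space if any two points are the endpoints of a geodesic. It has $\Delta$-thin triangles if, for every triangle with geodesic sides, each side lies in the $\Delta$-neighbourhood of the union of the other two. The translation length of an isometry $\tau$ is $t(\tau)=\inf_{x}d(x,\tau x)$, and its core is $\{x: d(x,\tau x)=t(\tau)\}$. An $\mathbb R$-tree is a metric space in which any two distinct points are joined by a unique arc, this arc being isometric to an interval. An isometry $\tau$ of an $\mathbb R$-tree is hyperbolic if $t(\tau)>0$ and its core (its axis) is isometric to $\mathbb R$; an action on an $\mathbb R$-tree is irreducible if two group elements are hyperbolic with disjoint axes. A subtree is a nonempty connected subset. A metric simplicial tree is an $\mathbb R$-tree with a nonempty closed discrete set of vertices whose complement is a union of open edges, an open edge being an open subset that is the open arc between two distinct vertices and contains no vertex. For an isometric action $\rho$ of a group $G$, put $L(\rho)(g)=t(\rho(g))$. $\mathrm{PLF}(G)=(\mathbb R^G\setminus 0)/(\mathbb R\setminus 0)$ has the quotient topology of the topology of pointwise convergence. Let $G$ be a group with a finite generating set $S$, let $\Delta>0$, and for $n\in\mathbb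 N$ let $\mathcal H_n$ be a geodesic space with $\Delta$-thin triangles and $\rho_n:G\to\mathrm{Isom}(\mathcal H_n)$ a homomorphism. Suppose that $(\rho_n)$ blows up: $t(\rho_n(\alpha))\to\infty$ for some $\alpha\in G$. Let $x_n\in\mathcal H_n$ be an approximate center of $\rho_n$: with $r_n(x)=\max_{\alpha\in S}d(x,\rho_n(\alpha)x)$, one has $r_n(x_n)\le r_n(y)+1$ for all $y\in\mathcal H_n$. Let $K$ be the complete graph with vertex set $G$ (including the points of its edges), with the action of $G$ that extends left multiplication linearly over the edges. Let $\iota_n:K\to\mathcal H_n$ be a $\rho_n$-equivariant map with $\iota_n(g)=\rho_n(g)x_n$ for $g\in G$ which is straight, i.e. $d(\iota_n(e(0)),\iota_n(e(t)))=t\,d(\iota_n(e(0)),\iota_n(e(1)))$ for every affine parametrization $e:[0,1]\to K$ of an edge and all $t\in[0,1]$. Put $d_n(p,q)=d_{\mathcal H_n}(\iota_n p,\iota_n q)$. (1) There are a subsequence $(n_i)$, numbers $\lambda_i>0$ with $\lambda_i\to0$, and a pseudo-metric $\bar d$ on $K$, not identically zero, such that $\lambda_i d_{n_i}\to\bar d$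 pointwise on $K\times K$. (2) Whenever $(n_i)$, $(\lambda_i)$ and $\bar d$ are as in (1), the metric space $\Gamma$ associated to $(K,\bar d)$ (points at distance $0$ are identified) is an $\mathbb R$-tree. The action of $G$ on $K$ covers a homomorphism $\sigma:G\to\mathrm{Isom}(\Gamma)$, some $\sigma(g)$ is hyperbolic, and $L(\rho_{n_i})\to L(\sigma)$ in $\mathrm{PLF}(G)$ (in particular $L(\sigma)\neq0$, and $L(\rho_{n_i})\ne0$ for all large $i$). (3) Suppose in addition that, in the situation of (2), $\sigma$ is irreducible and $L(\sigma)(g)\in\mathbb Z$ for all $g\in G$. Then there is a $G$-invariant subtree of $\Gamma$ that is contained in every $G$-invariant subtree, it is a metric simplicial tree, and the action of $G$ on it has the length function $L(\sigma)$. -/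

import Mathlib

open Filter Topology

namespace RTreeLimit

noncomputable section

/-! ### Geodesics, thin triangles, trees -/

section Metric

variable {X : Type*} [MetricSpace X]

/-- `s` is (the image of) a geodesic with endpoints `a` and `b`; it is `{a}` when `a = b`. -/
def IsGeodesicSegment (s : Set X) (a b : X) : Prop :=
  ∃ γ : ℝ → X, γ 0 = a ∧ γ (dist a b) = b ∧
    (∀ u ∈ Set.Icc 0 (dist a b), ∀ v ∈ Set.Icc 0 (dist a b), dist (γ u) (γ v) = |u - v|) ∧
    γ '' Set.Icc 0 (dist a b) = s

variable (X) in
/-- Any two points are the endpoints of a geodesic. -/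
def IsGeodesicSpace : Prop :=
  ∀ a b : X, ∃ s : Set X, IsGeodesicSegment s a b

/-- Every point of `p` is within distance `Δ` of `q`. -/
def WithinNhd (Δ : ℝ) (p q : Set X) : Prop :=
  ∀ x ∈ p, ∃ y ∈ q, dist x y ≤ Δ

variable (X) in
/-- Every geodesic triangle (with arbitrary choices of the sides) is `Δ`-thin: each side is
contained in the `Δ`-neighbourhood of the union of the other two. -/
def HasThinTriangles (Δ : ℝ) : Prop :=
  ∀ (a b c : X) (p q r : Set X),
    IsGeodesicSegment p a b → IsGeodesicSegment q b c → IsGeodesicSegment r c a →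
      WithinNhd Δ p (q ∪ r) ∧ WithinNhd Δ q (r ∪ p) ∧ WithinNhd Δ r (p ∪ q)

/-- `s` is an arc (homeomorphic image of `[0,1]`) with endpoints `a` and `b`. -/
def IsArc (s : Set X) (a b : X) : Prop :=
  ∃ γ : unitInterval → X, Continuous γ ∧ Function.Injective γ ∧ γ 0 = a ∧ γ 1 = b ∧
    Set.range γ = s

variable (X) in
/-- An `ℝ`-tree: any two distinct points are joined by exactly one arc, and this arc is isometric
to an interval, that is, it is a geodesic between its endpoints. -/
def IsRTree : Prop :=
  ∀ a b : X, a ≠ b → ∃ s : Set X, IsArc s a b ∧ IsGeodesicSegment s a b ∧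
    ∀ s' : Set X, IsArc s' a b → s' = s

/-- The points strictly between `a` and `b`. In an `ℝ`-tree this is the arc from `a` to `b`
without its endpoints. -/
def openArc (a b : X) : Set X :=
  {x | dist a x + dist x b = dist a b ∧ x ≠ a ∧ x ≠ b}

variable (X) in
/-- A metric simplicial tree: an `ℝ`-tree with a nonempty closed discrete set `V` of vertices such
that every point off `V` lies in an open edge. An open edge is an open segment between two
distinct vertices which contains no vertex and is an open subset of the space (so that it is a
whole connected component of the complement of `V`). -/
def IsMetricSimplicialTree : Prop :=
  IsRTree X ∧ ∃ V : Set X, V.Nonempty ∧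
    (∀ x : X, ∃ ε > 0, ∀ v ∈ V, dist x v < ε → v = x) ∧
    ∀ x : X, x ∉ V → ∃ v ∈ V, ∃ w ∈ V, v ≠ w ∧ x ∈ openArc v w ∧
      Disjoint (openArc v w) V ∧ IsOpen (openArc v w)

/-! ### Isometries -/

/-- The translation length `inf {d(x, τ x)}` of an isometry. -/
def translationLength (τ : X ≃ᵢ X) : ℝ := ⨅ x : X, dist x (τ x)

/-- The core of an isometry: the points moved the minimal distance. -/
def core (τ : X ≃ᵢ X) : Set X := {x | dist x (τ x) = translationLength τ}

/-- A hyperbolic isometry: positive translation length, and the core (then called the axis) is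
isometric to a line. -/
def IsHyperbolic (τ : X ≃ᵢ X) : Prop :=
  0 < translationLength τ ∧ ∃ f : ℝ → X, Isometry f ∧ Set.range f = core τ

variable {G : Type*} [Group G]

/-- The length function of an isometric action. -/
def lengthFunction (ρ : G →* (X ≃ᵢ X)) : G → ℝ := fun g => translationLength (ρ g)

/-- An irreducible action: there are two hyperbolic elements whose axes are disjoint. -/
def IsIrreducibleAction (ρ : G →* (X ≃ᵢ X)) : Prop :=
  ∃ a b : G, IsHyperbolic (ρ a) ∧ IsHyperbolic (ρ b) ∧ Disjoint (core (ρ a)) (core (ρ b))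

/-- A `G`-invariant subtree of an `ℝ`-tree: a nonempty connected subset preserved by `G`. -/
def IsInvariantSubtree (ρ : G →* (X ≃ᵢ X)) (T : Set X) : Prop :=
  IsConnected T ∧ ∀ g : G, ρ g '' T = T

/-- `r_S(x) = max {d(x, ρ(α) x) : α ∈ S}`. -/
def maxDisplacement (ρ : G →* (X ≃ᵢ X)) (S : Finset G) (x : X) : ℝ :=
  ⨆ α : S, dist x (ρ α x)

/-- An approximate center of `ρ`, relative to the finite generating set `S`. -/
def IsApproximateCenter (ρ : G →* (X ≃ᵢ X)) (S : Finset G) (x : X) : Prop :=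
  ∀ y : X, maxDisplacement ρ S x ≤ maxDisplacement ρ S y + 1

end Metric

/-- A sequence of representations blows up if the translation lengths of some element tend to
infinity. -/
def BlowsUp {G : Type*} [Group G] {H : ℕ → Type*} [∀ n, MetricSpace (H n)]
    (ρ : ∀ n, G →* (H n ≃ᵢ H n)) : Prop :=
  ∃ α : G, Tendsto (fun n => translationLength (ρ n α)) atTop atTop

/-! ### The complete graph with vertex set `G` -/

/-- The geometric realization of the complete graph with vertex set `G`, by barycentric
coordinates: finitely supported weights `w ≥ 0` of total mass `1`, with at most two vertices in
the support. -/
@[ext]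
structure CompleteGraph (G : Type*) where
  weight : G →₀ ℝ
  nonneg : ∀ g, 0 ≤ weight g
  sum_eq_one : (weight.sum fun _ t => t) = 1
  card_le_two : weight.support.card ≤ 2

namespace CompleteGraph

variable {G : Type*}

/-- The point `(1 - t) a + t b` of the edge with endpoints `a` and `b`. -/
def edgePoint (a b : G) (t : unitInterval) : CompleteGraph G where
  weight := Finsupp.single a (1 - (t : ℝ)) + Finsupp.single b (t : ℝ)
  nonneg g := by
    classical
    rw [Finsupp.add_apply, Finsupp.single_apply, Finsupp.single_apply]
    have h0 := t.2.1
    have h1 := t.2.2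
    split_ifs <;> linarith
  sum_eq_one := by
    rw [Finsupp.sum_add_index' (fun _ => rfl) (fun _ _ _ => rfl),
      Finsupp.sum_single_index rfl, Finsupp.sum_single_index rfl]
    ring
  card_le_two := by
    classical
    refine (Finset.card_le_card Finsupp.support_add).trans ((Finset.card_union_le _ _).trans ?_)
    have ha := Finset.card_le_card (Finsupp.support_single_subset (a := a) (b := 1 - (t : ℝ)))
    have hb := Finset.card_le_card (Finsupp.support_single_subset (a := b) (b := (t : ℝ)))
    rw [Finset.card_singleton] at ha hb
    omega

/-- The vertex `a`. -/
def vertex (a : G) : CompleteGraph G := edgePoint a a 0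

variable [Group G]

/-- The action of `G` by left multiplication on the vertices, extended linearly over the edges. -/
instance : MulAction G (CompleteGraph G) where
  smul g x :=
    { weight := Finsupp.equivMapDomain (Equiv.mulLeft g) x.weight
      nonneg := fun h => by
        rw [Finsupp.equivMapDomain_apply]
        exact x.nonneg _
      sum_eq_one := by
        rw [Finsupp.sum_equivMapDomain]
        exact x.sum_eq_one
      card_le_two := by
        have h : (Finsupp.equivMapDomain (Equiv.mulLeft g) x.weight).support =
            x.weight.support.map (Equiv.mulLeft g).toEmbedding := rfl
        rw [h, Finset.card_map]
        exact x.card_le_two }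
  one_smul x := by
    ext h
    change x.weight (1⁻¹ * h) = x.weight h
    simp
  mul_smul g k x := by
    ext h
    change x.weight ((g * k)⁻¹ * h) = x.weight (k⁻¹ * (g⁻¹ * h))
    simp [mul_assoc]

end CompleteGraph

open CompleteGraph

/-- A straight map from the complete graph to a metric space: for every edge and every affine
identification of the edge with `[0,1]`, one has `d(f(0), f(t)) = t d(f(0), f(1))`. -/
def IsStraight {G X : Type*} [MetricSpace X] (f : CompleteGraph G → X) : Prop :=
  ∀ (a b : G) (t : unitInterval),
    dist (f (vertex a)) (f (edgePoint a b t)) = t * dist (f (vertex a)) (f (vertex b))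

/-- Equivariance of a map from the complete graph with vertex set `G`. -/
def IsEquivariant {G X : Type*} [Group G] [MetricSpace X] (ρ : G →* (X ≃ᵢ X))
    (f : CompleteGraph G → X) : Prop :=
  ∀ (g : G) (x : CompleteGraph G), f (g • x) = ρ g (f x)

/-! ### Pseudo-metrics and rescaled limits -/

/-- The metric space associated to a pseudo-metric `D`: points at distance zero are identified. -/
def AssociatedSpace {K : Type*} (D : PseudoMetricSpace K) : Type _ :=
  @SeparationQuotient K D.toUniformSpace.toTopologicalSpace

instance {K : Type*} (D : PseudoMetricSpace K) : MetricSpace (AssociatedSpace D) :=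
  @SeparationQuotient.instMetricSpace K D

/-- The quotient map to the associated metric space. -/
def toAssociated {K : Type*} (D : PseudoMetricSpace K) (x : K) : AssociatedSpace D :=
  @SeparationQuotient.mk K D.toUniformSpace.toTopologicalSpace x

theorem dist_toAssociated {K : Type*} (D : PseudoMetricSpace K) (x y : K) :
    dist (toAssociated D x) (toAssociated D y) = D.dist x y :=
  @SeparationQuotient.dist_mk K D x y

/-- The action `σ` on the metric space associated to `D` is covered by the action of `G` on the
complete graph. -/
def IsCoveredBy {G : Type*} [Group G] (D : PseudoMetricSpace (CompleteGraph G))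
    (σ : G →* (AssociatedSpace D ≃ᵢ AssociatedSpace D)) : Prop :=
  ∀ (g : G) (x : CompleteGraph G), σ g (toAssociated D x) = toAssociated D (g • x)

/-- The pseudo-metrics `lam n • ι_{φ n}^* d`, for the subsequence `φ` and positive scaling factors
`lam n → 0`, converge pointwise to a pseudo-metric `D` which is not identically zero. -/
structure IsRescaledLimit {K : Type*} {H : ℕ → Type*} [∀ n, MetricSpace (H n)]
    (ι : ∀ n, K → H n) (φ : ℕ → ℕ) (lam : ℕ → ℝ) (D : PseudoMetricSpace K) : Prop where
  strictMono : StrictMono φ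
  pos : ∀ n, 0 < lam n
  tendsto_zero : Tendsto lam atTop (𝓝 0)
  tendsto_dist : ∀ x y : K,
    Tendsto (fun n => lam n * dist (ι (φ n) x) (ι (φ n) y)) atTop (𝓝 (D.dist x y))
  nonzero : ∃ x y : K, D.dist x y ≠ 0

/-! ### Projectivized length functions -/

/-- The space of projectivized length functions: nonzero functions `G → ℝ` (with the topology of
pointwise convergence) modulo nonzero scalars, with the quotient topology. -/
def PLF (G : Type*) : Type _ := Projectivization ℝ (G → ℝ)

instance (G : Type*) : TopologicalSpace (PLF G) :=
  inferInstanceAs (TopologicalSpace (Quotient (projectivizationSetoid ℝ (G → ℝ))))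

/-- The projective class of a nonzero length function. -/
def PLF.mk {G : Type*} (L : G → ℝ) (hL : L ≠ 0) : PLF G := Projectivization.mk ℝ L hL

/-- Convergence in `PLF G` of a sequence of length functions (nonzero from some index on) to a
nonzero length function. -/
def TendstoPLF {G : Type*} (L : ℕ → G → ℝ) (L' : G → ℝ) : Prop :=
  ∃ (h' : L' ≠ 0) (N : ℕ) (h : ∀ n, L (n + N) ≠ 0),
    Tendsto (fun n => PLF.mk (L (n + N)) (h n)) atTop (𝓝 (PLF.mk L' h'))

end

end RTreeLimit

open RTreeLimit

/-!
The proof rests on Gromov's four-point inequality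
`d(x,y) + d(z,w) ≤ max (d(x,z) + d(y,w)) (d(x,w) + d(y,z)) + C`.
Geodesic spaces with `Δ`-thin triangles satisfy it with `C = 6 Δ`
(`fourPoint_of_hasThinTriangles`). Up to such an error, the distance from a point between `a` and `b`
to a third point is determined by the distances of `a`, `b` and that point (`FourPoint.dist_le`),
and the translation length of `τ` is `max 0 (d(x, τ² x) - d(x, τ x))` for every `x`
(`FourPoint.le_translationLength`, `FourPoint.translationLength_le`).

After rescaling the error tends to `0`. Hence the rescaled metrics on the complete graph converge
as soon as they converge on the countable set of vertices (`exists_tendsto_dist`), where a diagonal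
argument applies; the metrics are divided by the displacements of the approximate centres, which
tend to infinity because the sequence blows up. The limit satisfies the four-point inequality
without error, and the edges of the graph become geodesics, so the limit is an `ℝ`-tree
(`FourPoint.isRTree`). The formula for translation lengths passes to the limit. The limiting length
function is nonzero: if no element were hyperbolic, the segments from the limit of the centres to
its images under the generators would begin in a common direction, and moving in this direction
would reduce all displacements (`FourPoint.exists_displacement_lt`), contrary to the choice of the
centres.

In the last part, let `x` be the endpoint, on the axis of `a`, of the segment connecting two
disjoint axes. The elements `a`, `a * b`, `a⁻¹ * b` have axes through `x` that join the three
directions at `x`, and multiplying an element `k` by a suitable one of them, or by its inverse,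
gives `u` with `d(x, k x) = L(k u) - L(u)`. So the orbit of `x` has integral distances
(`FourPoint.exists_integral_orbit`). The convex hull of this orbit is the least invariant subtree,
since every invariant subtree contains all axes, and it branches only at points at half-integral
distance from `x`, which form the set of vertices
(`FourPoint.isMetricSimplicialTree_orbitHull`).
-/

namespace RTreeLimit

/-! ### The four-point inequality -/

section FourPoint

variable {X : Type*} [MetricSpace X]

/-- The point `p` lies metrically between `a` and `b`: the triangle inequality for `a`, `p`, `b`
is an equality. In terms of Gromov products this says `(a | b)_p = 0`. -/
def Between (a p b : X) : Prop := dist a p + dist p b = dist a b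

variable (X) in
/-- Gromov's four-point inequality with additive constant `C`. -/
def FourPoint (C : ℝ) : Prop :=
  ∀ x y z w : X, dist x y + dist z w ≤ max (dist x z + dist y w) (dist x w + dist y z) + C

/-- There are points between `a` and `b` at all distances from `a` up to `d(a, b)`. -/
def Interpolates (a b : X) : Prop :=
  ∀ u : ℝ, 0 ≤ u → u ≤ dist a b → ∃ p, dist a p = u ∧ dist p b = dist a b - u

variable (X) in
/-- There are points between any two points at all possible distances. Together with the four-point
inequality without error this characterizes `ℝ`-trees. -/
def HasInterpolation : Prop :=
  ∀ a b : X, Interpolates a b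

theorem Interpolates.symm {a b : X} (h : Interpolates a b) : Interpolates b a := by
  intro u h0 h1
  rw [dist_comm] at h1
  obtain ⟨p, hp1, hp2⟩ := h (dist a b - u) (by linarith) (by linarith)
  exact ⟨p, by rw [dist_comm]; linarith, by rw [dist_comm, dist_comm b]; linarith⟩

theorem between_comm {a p b : X} : Between a p b ↔ Between b p a := by
  unfold Between
  rw [dist_comm a p, dist_comm p b, dist_comm a b, add_comm]

theorem Between.symm {a p b : X} (h : Between a p b) : Between b p a := between_comm.1 h

theorem IsGeodesicSegment.between {s : Set X} {a b p : X} (h : IsGeodesicSegment s a b)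
    (hp : p ∈ s) : Between a p b := by
  obtain ⟨γ, h0, h1, hγ, rfl⟩ := h
  obtain ⟨u, hu, rfl⟩ := hp
  have hd : (0 : ℝ) ≤ dist a b := dist_nonneg
  have e0 := hγ 0 ⟨le_rfl, hd⟩ u hu
  have e1 := hγ u hu (dist a b) ⟨hd, le_rfl⟩
  rw [h0, abs_of_nonpos (by linarith [hu.1])] at e0
  rw [h1, abs_of_nonpos (by linarith [hu.2])] at e1
  unfold Between
  linarith

theorem continuousOn_of_dist_eq {a b : X} {γ : ℝ → X}
    (hγ : ∀ u ∈ Set.Icc 0 (dist a b), ∀ v ∈ Set.Icc 0 (dist a b), dist (γ u) (γ v) = |u - v|) :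
    ContinuousOn γ (Set.Icc 0 (dist a b)) := by
  refine (LipschitzOnWith.of_dist_le_mul (K := 1) fun u hu v hv => ?_).continuousOn
  rw [hγ u hu v hv, Real.dist_eq, NNReal.coe_one, one_mul]

theorem IsGeodesicSegment.isCompact {s : Set X} {a b : X} (h : IsGeodesicSegment s a b) :
    IsCompact s := by
  obtain ⟨γ, -, -, hγ, rfl⟩ := h
  exact isCompact_Icc.image_of_continuousOn (continuousOn_of_dist_eq hγ)

theorem IsGeodesicSegment.isPreconnected {s : Set X} {a b : X} (h : IsGeodesicSegment s a b) :
    IsPreconnected s := by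
  obtain ⟨γ, -, -, hγ, rfl⟩ := h
  exact isPreconnected_Icc.image _ (continuousOn_of_dist_eq hγ)

theorem IsGeodesicSegment.left_mem {s : Set X} {a b : X} (h : IsGeodesicSegment s a b) :
    a ∈ s := by
  obtain ⟨γ, h0, -, -, rfl⟩ := h
  exact ⟨0, ⟨le_rfl, dist_nonneg⟩, h0⟩

theorem IsGeodesicSegment.right_mem {s : Set X} {a b : X} (h : IsGeodesicSegment s a b) :
    b ∈ s := by
  obtain ⟨γ, -, h1, -, rfl⟩ := h
  exact ⟨dist a b, ⟨dist_nonneg, le_rfl⟩, h1⟩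

theorem IsGeodesicSpace.hasInterpolation (h : IsGeodesicSpace X) : HasInterpolation X := by
  intro a b u hu0 hu1
  obtain ⟨s, γ, h0, h1, hγ, -⟩ := h a b
  have hd : (0 : ℝ) ≤ dist a b := dist_nonneg
  refine ⟨γ u, ?_, ?_⟩
  · have e := hγ 0 ⟨le_rfl, hd⟩ u ⟨hu0, hu1⟩
    rwa [h0, zero_sub, abs_neg, abs_of_nonneg hu0] at e
  · have e := hγ u ⟨hu0, hu1⟩ (dist a b) ⟨hd, le_rfl⟩
    rw [h1, abs_of_nonpos (by linarith)] at e
    linarith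

/-- By connectedness, a geodesic covered by the `Δ`-neighbourhoods of a compact set containing one
endpoint and a compact set containing the other has a point near both. -/
theorem IsGeodesicSegment.exists_near_both {s q r : Set X} {a b : X} {Δ : ℝ} (hΔ : 0 ≤ Δ)
    (hs : IsGeodesicSegment s a b) (hq : IsCompact q) (hr : IsCompact r) (hb : b ∈ q) (ha : a ∈ r)
    (h : WithinNhd Δ s (q ∪ r)) :
    ∃ p ∈ s, (∃ v ∈ q, dist p v ≤ Δ) ∧ ∃ u ∈ r, dist p u ≤ Δ := by
  have closed (t : Set X) : IsClosed {z : X | Metric.infDist z t ≤ Δ} :=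
    isClosed_le (Metric.continuous_infDist_pt t) continuous_const
  have cover : s ⊆ {z : X | Metric.infDist z q ≤ Δ} ∪ {z : X | Metric.infDist z r ≤ Δ} := by
    intro z hz
    obtain ⟨y, hy | hy, hzy⟩ := h z hz
    · exact Or.inl ((Metric.infDist_le_dist_of_mem hy).trans hzy)
    · exact Or.inr ((Metric.infDist_le_dist_of_mem hy).trans hzy)
  obtain ⟨p, hp, hpq, hpr⟩ := isPreconnected_closed_iff.1 hs.isPreconnected _ _ (closed q)
    (closed r) cover ⟨b, hs.right_mem, by simpa [Metric.infDist_zero_of_mem hb] using hΔ⟩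
    ⟨a, hs.left_mem, by simpa [Metric.infDist_zero_of_mem ha] using hΔ⟩
  obtain ⟨v, hv, hv'⟩ := hq.exists_infDist_eq_dist ⟨b, hb⟩ p
  obtain ⟨u, hu, hu'⟩ := hr.exists_infDist_eq_dist ⟨a, ha⟩ p
  exact ⟨p, hp, ⟨v, hv, hv' ▸ hpq⟩, u, hu, hu' ▸ hpr⟩

/-- Thin triangles imply the four-point inequality: the Gromov product `(x | y)_w` agrees up to
`2 Δ` with the distance from `w` to a geodesic from `x` to `y`. -/
theorem fourPoint_of_hasThinTriangles {Δ : ℝ} (hΔ : 0 ≤ Δ) (hg : IsGeodesicSpace X)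
    (ht : HasThinTriangles X Δ) : FourPoint X (6 * Δ) := by
  intro x y z w
  obtain ⟨p, hp⟩ := hg x y
  obtain ⟨q, hq⟩ := hg y w
  obtain ⟨r, hr⟩ := hg w x
  obtain ⟨q', hq'⟩ := hg y z
  obtain ⟨r', hr'⟩ := hg z x
  -- `P` is a point of the side from `x` to `y` close to both sides issuing from `w`.
  obtain ⟨P, hP, ⟨v, hv, hPv⟩, u, hu, hPu⟩ := hp.exists_near_both hΔ hq.isCompact hr.isCompact
    hq.left_mem hr.right_mem (ht x y w p q r hp hq hr).1
  have e1 := hq.between hv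
  have e2 := hr.between hu
  have e3 := hp.between hP
  unfold Between at e1 e2 e3
  have t1 := dist_triangle y v P
  have t2 := dist_triangle P v w
  have t3 := dist_triangle w u P
  have t4 := dist_triangle P u x
  have c1 := dist_comm v P
  have c2 := dist_comm u P
  have c3 := dist_comm P w
  have c4 := dist_comm P x
  have c5 := dist_comm P y
  have c6 := dist_comm w x
  have c7 := dist_comm z w
  obtain ⟨Q, hQ | hQ, hPQ⟩ := (ht x y z p q' r' hp hq' hr').1 P hP
  · have e4 := hq'.between hQ
    unfold Between at e4
    have t5 := dist_triangle y Q w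
    have t6 := dist_triangle z Q w
    have t7 := dist_triangle Q P w
    have c8 := dist_comm Q P
    have c9 := dist_comm Q z
    have := le_max_right (dist x z + dist y w) (dist x w + dist y z)
    linarith
  · have e4 := hr'.between hQ
    unfold Between at e4
    have t5 := dist_triangle x Q w
    have t6 := dist_triangle z Q w
    have t7 := dist_triangle Q P w
    have c8 := dist_comm Q P
    have c9 := dist_comm Q x
    have c10 := dist_comm z x
    have := le_max_left (dist x z + dist y w) (dist x w + dist y z)
    linarith

/-- In a space satisfying the four-point inequality, the distance from `c` to a point `p` between
`a` and `b` is determined, up to the constant, by the distances of `a`, `b`, `c` (the reverse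
inequality holds without error by the triangle inequality). -/
theorem FourPoint.dist_le {C : ℝ} (h : FourPoint X C) {a p b : X} (hp : Between a p b) (c : X) :
    dist p c ≤ max (dist a c - dist a p) (dist b c - dist p b) + C := by
  have h4 := h p c a b
  unfold Between at hp
  rw [dist_comm p a, dist_comm c b, dist_comm c a] at h4
  rcases max_cases (dist a p + dist b c) (dist p b + dist a c) with ⟨e, -⟩ | ⟨e, -⟩ <;>
    rw [e] at h4
  · have := le_max_right (dist a c - dist a p) (dist b c - dist p b)
    linarith
  · have := le_max_left (dist a c - dist a p) (dist b c - dist p b)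
    linarith

theorem le_dist_of_between {a p b : X} (c : X) :
    max (dist a c - dist a p) (dist b c - dist p b) ≤ dist p c := by
  have t1 := dist_triangle a p c
  have t2 := dist_triangle b p c
  have := dist_comm b p
  exact max_le (by linarith) (by linarith)

/-! ### Translation lengths -/

theorem translationLength_nonneg (τ : X ≃ᵢ X) : 0 ≤ translationLength τ :=
  Real.iInf_nonneg fun _ => dist_nonneg

theorem translationLength_le_dist (τ : X ≃ᵢ X) (x : X) : translationLength τ ≤ dist x (τ x) :=
  ciInf_le ⟨0, by rintro _ ⟨y, rfl⟩; exact dist_nonneg⟩ x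

theorem FourPoint.le_translationLength {C : ℝ} (h : FourPoint X C) (τ : X ≃ᵢ X) (x : X) :
    dist x (τ (τ x)) - dist x (τ x) - C ≤ translationLength τ := by
  have : Nonempty X := ⟨x⟩
  refine le_ciInf fun y => ?_
  have h4 := h x (τ (τ x)) (τ x) (τ y)
  have t1 := dist_triangle (τ x) (τ y) y
  have t2 := dist_triangle x y (τ y)
  rw [dist_comm (τ (τ x)) (τ y), dist_comm (τ (τ x)) (τ x), τ.dist_eq, τ.dist_eq, τ.dist_eq,
    dist_comm y (τ x)] at h4
  rw [τ.dist_eq, dist_comm (τ y) y] at t1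
  rcases max_cases (dist x (τ x) + dist (τ x) y) (dist x (τ y) + dist x (τ x)) with ⟨e, -⟩ | ⟨e, -⟩
    <;> rw [e] at h4 <;> linarith

/-- The midpoint of `x` and `τ x` is moved almost minimally. -/
theorem FourPoint.exists_dist_le {C : ℝ} (h : FourPoint X C) (hX : HasInterpolation X)
    (τ : X ≃ᵢ X) (x : X) : ∃ m, Between x m (τ x) ∧
      dist m (τ m) ≤ max 0 (dist x (τ (τ x)) - dist x (τ x)) + 2 * C := by
  have hd : (0 : ℝ) ≤ dist x (τ x) := dist_nonneg
  obtain ⟨m, hm1, hm2⟩ := hX x (τ x) (dist x (τ x) / 2) (by linarith) (by linarith)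
  have hm : Between x m (τ x) := by unfold Between; linarith
  have hm' : Between (τ x) (τ m) (τ (τ x)) := by
    unfold Between; rw [τ.dist_eq, τ.dist_eq, τ.dist_eq]; exact hm
  refine ⟨m, hm, ?_⟩
  have e1 := h.dist_le hm (τ (τ x))
  have e2 := h.dist_le hm' m
  rw [τ.dist_eq, τ.dist_eq, dist_comm (τ x) m, dist_comm (τ (τ x)) m, dist_comm (τ m) m] at e2
  rw [τ.dist_eq] at e1
  have hC : 0 ≤ C := by simpa using h x x x x
  have m1 := le_max_left 0 (dist x (τ (τ x)) - dist x (τ x))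
  have m2 := le_max_right 0 (dist x (τ (τ x)) - dist x (τ x))
  rcases max_cases (dist x (τ (τ x)) - dist x m) (dist x (τ x) - dist m (τ x)) with
    ⟨f, -⟩ | ⟨f, -⟩ <;> rw [f] at e1 <;>
  rcases max_cases (dist m (τ x) - dist x m) (dist m (τ (τ x)) - dist m (τ x)) with
    ⟨f', -⟩ | ⟨f', -⟩ <;> rw [f'] at e2 <;> linarith

theorem FourPoint.translationLength_le {C : ℝ} (h : FourPoint X C) (hX : HasInterpolation X)
    (τ : X ≃ᵢ X) (x : X) :
    translationLength τ ≤ max 0 (dist x (τ (τ x)) - dist x (τ x)) + 2 * C := by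
  obtain ⟨m, -, hm⟩ := h.exists_dist_le hX τ x
  exact (translationLength_le_dist τ m).trans hm

end FourPoint

/-! ### Spaces satisfying the four-point inequality without error -/

section Tree

variable {X : Type*} [MetricSpace X]

theorem Between.trans_left {a p b c : X} (h : Between a p b) (h' : Between a b c) :
    Between a p c := by
  unfold Between at *
  have t1 := dist_triangle p b c
  have t2 := dist_triangle a p c
  linarith

theorem Between.trans_right {a p b c : X} (h : Between b p c) (h' : Between a b c) :
    Between a p c :=
  (h.symm.trans_left h'.symm).symm

theorem Between.map {a p b : X} (h : Between a p b) (τ : X ≃ᵢ X) :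
    Between (τ a) (τ p) (τ b) := by
  unfold Between at *
  rwa [τ.dist_eq, τ.dist_eq, τ.dist_eq]

/-- A point on the segment from `a` to `b` lies on one of the other two sides of the triangle
`a`, `b`, `c`. -/
theorem FourPoint.between_or (h : FourPoint X 0) {a m b : X} (hm : Between a m b) (c : X) :
    Between a m c ∨ Between c m b := by
  have h4 := h a b c m
  unfold Between at *
  have t1 := dist_triangle a m c
  have t2 := dist_triangle c m b
  have := dist_comm c m
  have := dist_comm b m
  have := dist_comm b c
  rcases max_cases (dist a c + dist b m) (dist a m + dist b c) with ⟨e, -⟩ | ⟨e, -⟩ <;>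
    rw [e] at h4
  · left; linarith
  · right; linarith

/-- Local geodesics are geodesics: two segments that overlap in a nondegenerate segment form a
segment. -/
theorem FourPoint.dist_chain (h : FourPoint X 0) {a b c d : X} (h1 : Between a b c)
    (h2 : Between b c d) (hbc : b ≠ c) : dist a d = dist a b + dist b c + dist c d := by
  have h4 := h a c b d
  have := dist_pos.2 hbc
  have t1 := dist_triangle a b d
  unfold Between at *
  rw [dist_comm c b] at h4
  rcases max_cases (dist a b + dist c d) (dist a d + dist b c) with ⟨e, -⟩ | ⟨e, -⟩ <;>
    rw [e] at h4 <;> linarith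

theorem FourPoint.dist_eq_abs (h : FourPoint X 0) {a b p q : X} (hp : Between a p b)
    (hq : Between a q b) : dist p q = |dist a p - dist a q| := by
  have h1 := h.dist_le hp q
  have h2 := le_dist_of_between (a := a) (p := p) (b := b) q
  unfold Between at *
  rw [add_zero] at h1
  rw [le_antisymm h1 h2, abs_eq_max_neg, max_comm, dist_comm b q]
  congr 1 <;> linarith

theorem FourPoint.eq_of_between (h : FourPoint X 0) {a b p q : X} (hp : Between a p b)
    (hq : Between a q b) (e : dist a p = dist a q) : p = q := by
  rw [← dist_eq_zero, h.dist_eq_abs hp hq, e, sub_self, abs_zero]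

theorem FourPoint.interpolates_trans (h : FourPoint X 0) {a b c : X} (hab : Interpolates a b)
    (hbc : Interpolates b c) : Interpolates a c := by
  intro u hu0 hu1
  have t1 := dist_triangle b a c
  have t2 := dist_triangle a c b
  have t3 := dist_triangle a b c
  have := dist_comm a b
  have := dist_comm c b
  -- The centre of the triangle has distance `(b | c)_a` from `a`.
  rcases le_total (2 * u) (dist a b + dist a c - dist b c) with hu | hu
  · obtain ⟨p, hp1, hp2⟩ := hab u hu0 (by linarith)
    refine ⟨p, hp1, ?_⟩
    have hp : Between a p b := by unfold Between; linarith
    have h1 := h.dist_le hp c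
    have t4 := dist_triangle a p c
    have : max (dist a c - dist a p) (dist b c - dist p b) ≤ dist a c - u :=
      max_le (by linarith) (by linarith)
    linarith
  · obtain ⟨p, hp1, hp2⟩ := hbc (dist b c - (dist a c - u)) (by linarith) (by linarith)
    have hp : Between b p c := by unfold Between; linarith
    have h1 := h.dist_le hp a
    have t4 := dist_triangle a p c
    have := dist_comm p a
    have := dist_comm c a
    have : max (dist b a - dist b p) (dist c a - dist p c) ≤ u :=
      max_le (by linarith) (by linarith)
    exact ⟨p, by linarith, by linarith⟩

/-- Every point between `a` and `b` separates them. -/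
theorem FourPoint.mem_of_isPreconnected (h : FourPoint X 0) {s : Set X} (hs : IsPreconnected s)
    {a b m : X} (ha : a ∈ s) (hb : b ∈ s) (hm : Between a m b) : m ∈ s := by
  by_contra hms
  have hU : IsOpen {x : X | dist x a < dist x m + dist m a} :=
    isOpen_lt (by fun_prop) (by fun_prop)
  have hV : IsOpen {x : X | x ≠ m ∧ Between x m a} := by
    refine Metric.isOpen_iff.2 fun x hx => ⟨dist x m, dist_pos.2 hx.1, fun y hy => ?_⟩
    rw [Metric.mem_ball, dist_comm] at hy
    refine ⟨fun e => by rw [e] at hy; exact lt_irrefl _ hy, ?_⟩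
    rcases h.between_or hx.2 y with h' | h'
    · unfold Between at h'
      have : 0 ≤ dist m y := dist_nonneg
      linarith
    · exact h'
  have hne {x : X} (hx : x ∈ s) : x ≠ m := fun e => hms (e ▸ hx)
  obtain ⟨z, -, hz1, -, hz2⟩ := hs _ _ hU hV
    (fun x hx => by
      rcases (dist_triangle x m a).lt_or_eq with h' | h'
      · exact Or.inl h'
      · exact Or.inr ⟨hne hx, h'.symm⟩)
    ⟨a, ha, by
      have := dist_pos.2 (hne ha)
      have := dist_comm m a
      change dist a a < dist a m + dist m a
      rw [dist_self]; linarith⟩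
    ⟨b, hb, hne hb, hm.symm⟩
  exact absurd hz2 (ne_of_gt hz1)

/-- A metric space with interpolation satisfying the four-point inequality without error is an
`ℝ`-tree. The geodesic from `a` to `b` is contained in every arc from `a` to `b` because its points
separate `a` from `b`, and the preimage of the geodesic in the arc is connected. -/
theorem FourPoint.isRTree (h : FourPoint X 0) (hX : HasInterpolation X) : IsRTree X := by
  intro a b hab
  have hL : 0 < dist a b := dist_pos.2 hab
  have key : ∀ u : ℝ, ∃ q, u ∈ Set.Icc 0 (dist a b) → dist a q = u ∧ dist q b = dist a b - u := by
    intro u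
    by_cases hu : u ∈ Set.Icc 0 (dist a b)
    · obtain ⟨q, hq⟩ := hX a b u hu.1 hu.2
      exact ⟨q, fun _ => hq⟩
    · exact ⟨a, fun h => absurd h hu⟩
  choose γ hγ using key
  have hbet (u : ℝ) (hu : u ∈ Set.Icc 0 (dist a b)) : Between a (γ u) b := by
    unfold Between
    linarith [(hγ u hu).1, (hγ u hu).2]
  have hdist (u : ℝ) (hu : u ∈ Set.Icc 0 (dist a b)) (v : ℝ) (hv : v ∈ Set.Icc 0 (dist a b)) :
      dist (γ u) (γ v) = |u - v| := by
    rw [h.dist_eq_abs (hbet u hu) (hbet v hv), (hγ u hu).1, (hγ v hv).1]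
  have h0 : γ 0 = a := (dist_eq_zero.1 (hγ 0 ⟨le_rfl, hL.le⟩).1).symm
  have h1 : γ (dist a b) = b :=
    dist_eq_zero.1 ((hγ _ ⟨hL.le, le_rfl⟩).2.trans (sub_self _))
  have hseg : IsGeodesicSegment (γ '' Set.Icc 0 (dist a b)) a b := ⟨γ, h0, h1, hdist, rfl⟩
  have hmem (t : unitInterval) : (t : ℝ) * dist a b ∈ Set.Icc 0 (dist a b) :=
    ⟨mul_nonneg t.2.1 hL.le, mul_le_of_le_one_left hL.le t.2.2⟩
  refine ⟨γ '' Set.Icc 0 (dist a b), ⟨fun t => γ (t * dist a b), ?_, ?_, ?_, ?_, ?_⟩, hseg, ?_⟩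
  · exact (continuousOn_of_dist_eq hdist).comp_continuous (by fun_prop) hmem
  · intro s t hst
    have e := hdist _ (hmem s) _ (hmem t)
    have hst' : γ (s * dist a b) = γ (t * dist a b) := hst
    rw [hst', dist_self, ← sub_mul] at e
    rcases mul_eq_zero.1 (abs_eq_zero.1 e.symm) with e' | e'
    · exact Subtype.ext (sub_eq_zero.1 e')
    · exact absurd e' hL.ne'
  · simp [h0]
  · simp [h1]
  · ext z
    constructor
    · rintro ⟨t, rfl⟩
      exact ⟨_, hmem t, rfl⟩
    · rintro ⟨u, hu, rfl⟩
      refine ⟨⟨u / dist a b, div_nonneg hu.1 hL.le, (div_le_one hL).2 hu.2⟩, ?_⟩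
      simp [div_mul_cancel₀ _ hL.ne']
  · rintro s' ⟨δ, hδc, hδi, hδ0, hδ1, rfl⟩
    have hsub : γ '' Set.Icc 0 (dist a b) ⊆ Set.range δ := fun p hp =>
      h.mem_of_isPreconnected (isPreconnected_range hδc) ⟨0, hδ0⟩ ⟨1, hδ1⟩ (hseg.between hp)
    refine Set.Subset.antisymm ?_ hsub
    have hpre := hseg.isPreconnected.preimage_of_isClosedMap hδi hδc.isClosedMap hsub
    have hord := hpre.ordConnected
    rintro _ ⟨t, rfl⟩
    exact hord.out (show (0 : unitInterval) ∈ _ by rw [Set.mem_preimage, hδ0]; exact hseg.left_mem)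
      (show (1 : unitInterval) ∈ _ by rw [Set.mem_preimage, hδ1]; exact hseg.right_mem)
      ⟨t.2.1, t.2.2⟩

/-! ### Isometries of trees -/

theorem FourPoint.translationLength_eq (h : FourPoint X 0) (hX : HasInterpolation X)
    (τ : X ≃ᵢ X) (x : X) :
    translationLength τ = max 0 (dist x (τ (τ x)) - dist x (τ x)) := by
  have h1 := h.translationLength_le hX τ x
  have h2 := h.le_translationLength τ x
  refine le_antisymm (by linarith) (max_le (translationLength_nonneg τ) (by linarith))

theorem FourPoint.exists_mem_core (h : FourPoint X 0) (hX : HasInterpolation X)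
    (τ : X ≃ᵢ X) (x : X) : ∃ m ∈ core τ, Between x m (τ x) := by
  obtain ⟨m, hm, hm'⟩ := h.exists_dist_le hX τ x
  refine ⟨m, le_antisymm ?_ (translationLength_le_dist τ m), hm⟩
  rw [h.translationLength_eq hX τ x]
  linarith

theorem mem_core_iff {τ : X ≃ᵢ X} {x : X} : x ∈ core τ ↔ dist x (τ x) = translationLength τ :=
  Iff.rfl

theorem FourPoint.mem_core_of_between (h : FourPoint X 0) {τ : X ≃ᵢ X} {x y p : X}
    (hx : x ∈ core τ) (hy : y ∈ core τ) (hp : Between x p y) : p ∈ core τ := by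
  refine le_antisymm ?_ (translationLength_le_dist τ p)
  rw [mem_core_iff] at hx hy
  have h1 := h.dist_le (hp.map τ) p
  have h2 := h.dist_le hp (τ x)
  have h3 := h.dist_le hp (τ y)
  have t1 := dist_triangle x y (τ y)
  have t2 := dist_triangle y x (τ x)
  rw [τ.dist_eq, τ.dist_eq, dist_comm (τ x) p, dist_comm (τ y) p, dist_comm (τ p) p] at h1
  unfold Between at hp
  have := dist_comm y x
  have hxp : 0 ≤ dist x p := dist_nonneg
  have hpy : 0 ≤ dist p y := dist_nonneg
  rcases max_cases (dist p (τ x) - dist x p) (dist p (τ y) - dist p y) with ⟨e, -⟩ | ⟨e, -⟩ <;>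
    rw [e] at h1 <;>
  rcases max_cases (dist x (τ x) - dist x p) (dist y (τ x) - dist p y) with ⟨e, -⟩ | ⟨e, -⟩ <;>
    rw [e] at h2 <;>
  rcases max_cases (dist x (τ y) - dist x p) (dist y (τ y) - dist p y) with ⟨e, -⟩ | ⟨e, -⟩ <;>
    rw [e] at h3 <;> linarith

theorem isClosed_core (τ : X ≃ᵢ X) : IsClosed (core τ) :=
  isClosed_eq (continuous_id.dist τ.continuous) continuous_const

theorem FourPoint.dist_zpow_of_mem_core (h : FourPoint X 0) (hX : HasInterpolation X)
    {τ : X ≃ᵢ X} (hτ : 0 < translationLength τ) {x : X} (hx : x ∈ core τ) (i j : ℤ) :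
    dist ((τ ^ i) x) ((τ ^ j) x) = |(i : ℝ) - j| * translationLength τ := by
  rw [mem_core_iff] at hx
  have h2 : dist x (τ (τ x)) = 2 * translationLength τ := by
    have := h.translationLength_eq hX τ x
    rcases max_cases 0 (dist x (τ (τ x)) - dist x (τ x)) with ⟨e, -⟩ | ⟨e, -⟩ <;>
      rw [e] at this <;> linarith
  have hnat (n : ℕ) : dist x ((τ ^ n) x) = n * translationLength τ ∧
      dist x ((τ ^ (n + 1)) x) = (n + 1) * translationLength τ := by
    induction n with
    | zero => simpa using hx
    | succ n ih =>
      have e1 : (τ ^ (n + 1)) x = (τ ^ n) (τ x) := by rw [pow_succ]; rfl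
      have e2 : (τ ^ (n + 1 + 1)) x = (τ ^ n) (τ (τ x)) := by rw [pow_succ, pow_succ]; rfl
      rw [e1] at ih ⊢
      rw [e2]
      obtain ⟨ih1, ih2⟩ := ih
      have d1 : dist ((τ ^ n) x) ((τ ^ n) (τ x)) = translationLength τ := by
        rw [(τ ^ n).dist_eq, hx]
      have d2 : dist ((τ ^ n) (τ x)) ((τ ^ n) (τ (τ x))) = translationLength τ := by
        rw [(τ ^ n).dist_eq, τ.dist_eq, hx]
      have d3 : dist ((τ ^ n) x) ((τ ^ n) (τ (τ x))) = 2 * translationLength τ := by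
        rw [(τ ^ n).dist_eq, h2]
      have := h.dist_chain (a := x) (b := (τ ^ n) x) (c := (τ ^ n) (τ x))
        (d := (τ ^ n) (τ (τ x))) (by unfold Between; linarith) (by unfold Between; linarith)
        (by rw [← dist_pos, d1]; exact hτ)
      push_cast
      constructor <;> linarith
  have hint (k : ℤ) : dist x ((τ ^ k) x) = |(k : ℝ)| * translationLength τ := by
    obtain ⟨n, rfl | rfl⟩ := k.eq_nat_or_neg
    · rw [zpow_natCast, (hnat n).1]; simp
    · have e : dist x ((τ ^ (-(n : ℤ))) x) = dist ((τ ^ n) x) x := by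
        rw [← (τ ^ n).dist_eq x, zpow_neg, zpow_natCast, IsometryEquiv.apply_inv_self]
      rw [e, dist_comm, (hnat n).1]; simp
  have e : (τ ^ j) x = (τ ^ i) ((τ ^ (j - i)) x) := by
    rw [← IsometryEquiv.mul_apply, ← zpow_add]; congr 2; ring
  rw [e, (τ ^ i).dist_eq, hint, abs_sub_comm]
  push_cast
  rfl

/-- The axis of a hyperbolic isometry `τ` is contained in the hull of any of its orbits. -/
theorem FourPoint.exists_between_zpow (h : FourPoint X 0) (hX : HasInterpolation X)
    {τ : X ≃ᵢ X} (hτ : 0 < translationLength τ) {x : X} (hx : x ∈ core τ) (y : X) :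
    ∃ n : ℕ, Between ((τ ^ (-(n : ℤ))) y) x ((τ ^ (n : ℤ)) y) := by
  obtain ⟨n, hn⟩ := exists_nat_gt (dist x y / translationLength τ)
  rw [div_lt_iff₀ hτ] at hn
  refine ⟨n, ?_⟩
  have e0 : (τ ^ (0 : ℤ)) x = x := by simp
  have d1 := h.dist_zpow_of_mem_core hX hτ hx (-n) 0
  have d2 := h.dist_zpow_of_mem_core hX hτ hx 0 n
  have d3 := h.dist_zpow_of_mem_core hX hτ hx (-n) n
  have d4 := (τ ^ (-(n : ℤ))).dist_eq x y
  have d5 := (τ ^ (n : ℤ)).dist_eq x y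
  rw [e0] at d1 d2
  push_cast at d1 d2 d3
  have hn0 : (0 : ℝ) ≤ n := n.cast_nonneg
  rw [sub_zero, abs_neg, abs_of_nonneg hn0] at d1
  rw [zero_sub, abs_neg, abs_of_nonneg hn0] at d2
  rw [abs_of_nonpos (by linarith)] at d3
  have hb : Between ((τ ^ (-(n : ℤ))) x) x ((τ ^ (n : ℤ)) x) := by
    unfold Between; linarith
  -- `τ⁻ⁿ y` and `τⁿ y` lie in the same directions from `x` as `τ⁻ⁿ x` and `τⁿ x`.
  rcases h.between_or hb ((τ ^ (-(n : ℤ))) y) with h1 | h1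
  · unfold Between at h1
    have : 0 ≤ dist x ((τ ^ (-(n : ℤ))) y) := dist_nonneg
    linarith
  rcases h.between_or h1 ((τ ^ (n : ℤ)) y) with h2 | h2
  · exact h2
  · unfold Between at h2
    have := dist_comm ((τ ^ (n : ℤ)) y) x
    have := dist_comm ((τ ^ (n : ℤ)) y) ((τ ^ (n : ℤ)) x)
    have : 0 ≤ dist ((τ ^ (n : ℤ)) y) x := dist_nonneg
    linarith

/-- The points of the axis through `m` are parametrized by their signed distance `s` from `m`. -/
theorem FourPoint.exists_axis_point (h : FourPoint X 0) (hX : HasInterpolation X)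
    {τ : X ≃ᵢ X} (hτ : 0 < translationLength τ) {m : X} (hm : m ∈ core τ) (s : ℝ) :
    ∃ p, ∀ k : ℤ, dist ((τ ^ k) m) p = |s - k * translationLength τ| := by
  have D := h.dist_zpow_of_mem_core hX hτ hm
  set t := translationLength τ
  obtain ⟨n, hn⟩ := exists_nat_gt (|s| / t)
  rw [div_lt_iff₀ hτ, abs_lt] at hn
  have hn0 : (0 : ℝ) ≤ n := n.cast_nonneg
  have dab : dist ((τ ^ (-(n : ℤ))) m) ((τ ^ (n : ℤ)) m) = 2 * n * t := by
    rw [D, abs_of_nonpos (by push_cast; linarith)]; push_cast; ring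
  obtain ⟨p, hp1, hp2⟩ := hX ((τ ^ (-(n : ℤ))) m) ((τ ^ (n : ℤ)) m) (s + n * t) (by linarith)
    (by rw [dab]; linarith)
  have hp : Between ((τ ^ (-(n : ℤ))) m) p ((τ ^ (n : ℤ)) m) := by unfold Between; linarith
  refine ⟨p, fun k => ?_⟩
  rcases lt_or_ge (n : ℤ) k with hk | hk
  · have hk' : (n : ℝ) < k := by exact_mod_cast hk
    have hkt := mul_lt_mul_of_pos_right hk' hτ
    have d1 := D (-n) k
    have d2 := D n k
    push_cast at d1 d2
    rw [abs_of_nonpos (by linarith)] at d1 d2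
    have hb : Between ((τ ^ (-(n : ℤ))) m) ((τ ^ (n : ℤ)) m) ((τ ^ k) m) := by
      unfold Between; linarith
    have := hp.trans_left hb
    unfold Between at this
    rw [abs_of_nonpos (by linarith), dist_comm]
    linarith
  rcases lt_or_ge k (-(n : ℤ)) with hk2 | hk2
  · have hk' : (k : ℝ) < -n := by exact_mod_cast hk2
    have hkt := mul_lt_mul_of_pos_right hk' hτ
    have d1 := D k n
    have d2 := D k (-n)
    push_cast at d1 d2
    rw [abs_of_nonpos (by linarith)] at d1 d2
    have hb : Between ((τ ^ k) m) ((τ ^ (-(n : ℤ))) m) ((τ ^ (n : ℤ)) m) := by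
      unfold Between; linarith
    have := hp.trans_right hb
    unfold Between at this
    rw [abs_of_nonneg (by linarith)]
    linarith
  · have hk' : (k : ℝ) ≤ n := by exact_mod_cast hk
    have hk2' : -(n : ℝ) ≤ k := by exact_mod_cast hk2
    have d1 := D (-n) k
    have d2 := D k n
    push_cast at d1 d2
    rw [abs_of_nonpos (by linarith)] at d1 d2
    have hb : Between ((τ ^ (-(n : ℤ))) m) ((τ ^ k) m) ((τ ^ (n : ℤ)) m) := by
      unfold Between; linarith
    rw [h.dist_eq_abs hb hp, d1, hp1, abs_sub_comm]
    congr 1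
    ring

/-- In a tree, an isometry of positive translation length is hyperbolic: its core is a line. -/
theorem FourPoint.isHyperbolic (h : FourPoint X 0) (hX : HasInterpolation X)
    {τ : X ≃ᵢ X} (hτ : 0 < translationLength τ) (x : X) : IsHyperbolic τ := by
  refine ⟨hτ, ?_⟩
  obtain ⟨m, hm, -⟩ := h.exists_mem_core hX τ x
  have D := h.dist_zpow_of_mem_core hX hτ hm
  choose f hf using h.exists_axis_point hX hτ hm
  -- A point is determined by its distances from the points `τ ^ k m`.
  have key (s s' : ℝ) (p p' : X) (hp : ∀ k : ℤ, dist ((τ ^ k) m) p = |s - k * translationLength τ|)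
      (hp' : ∀ k : ℤ, dist ((τ ^ k) m) p' = |s' - k * translationLength τ|) :
      dist p p' = |s - s'| := by
    obtain ⟨n, hn⟩ := exists_nat_gt ((|s| + |s'|) / translationLength τ)
    rw [div_lt_iff₀ hτ] at hn
    have hn0 : (0 : ℝ) ≤ n := n.cast_nonneg
    have dab : dist ((τ ^ (-(n : ℤ))) m) ((τ ^ (n : ℤ)) m) = 2 * n * translationLength τ := by
      rw [D, abs_of_nonpos (by push_cast; linarith)]; push_cast; ring
    have b (s : ℝ) (p : X) (hs : |s| < n * translationLength τ)
        (hp : ∀ k : ℤ, dist ((τ ^ k) m) p = |s - k * translationLength τ|) :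
        dist ((τ ^ (-(n : ℤ))) m) p = s + n * translationLength τ ∧
        Between ((τ ^ (-(n : ℤ))) m) p ((τ ^ (n : ℤ)) m) := by
      rw [abs_lt] at hs
      have e1 := hp (-n)
      have e2 := hp n
      push_cast at e1 e2
      rw [abs_of_nonneg (by linarith)] at e1
      rw [abs_of_nonpos (by linarith), dist_comm] at e2
      refine ⟨by linarith, ?_⟩
      unfold Between; linarith
    have b1 := b s p (by linarith [abs_nonneg s']) hp
    have b2 := b s' p' (by linarith [abs_nonneg s]) hp'
    rw [h.dist_eq_abs b1.2 b2.2, b1.1, b2.1]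
    congr 1
    ring
  refine ⟨f, Isometry.of_dist_eq fun s s' => ?_, ?_⟩
  · rw [key s s' _ _ (hf s) (hf s'), Real.dist_eq]
  · ext y
    constructor
    · rintro ⟨s, rfl⟩
      have hs (k : ℤ) : dist ((τ ^ k) m) (τ (f s)) =
          |(s + translationLength τ) - k * translationLength τ| := by
        have e : (τ ^ k) m = τ ((τ ^ (k - 1)) m) := by
          rw [← IsometryEquiv.mul_apply, ← zpow_one_add]; congr 2; ring
        rw [e, τ.dist_eq, hf]
        congr 1
        push_cast
        ring
      rw [mem_core_iff, key _ _ _ _ (hf s) hs, sub_add_cancel_left, abs_neg, abs_of_pos hτ]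
    · intro hy
      obtain ⟨n, hn⟩ := h.exists_between_zpow hX hτ hy m
      have hn0 : (0 : ℝ) ≤ n := n.cast_nonneg
      have dab : dist ((τ ^ (-(n : ℤ))) m) ((τ ^ (n : ℤ)) m) = 2 * n * translationLength τ := by
        rw [D, abs_of_nonpos (by push_cast; linarith)]; push_cast; ring
      set a := (τ ^ (-(n : ℤ))) m
      have hay : 0 ≤ dist a y := dist_nonneg
      have hyb : 0 ≤ dist y ((τ ^ (n : ℤ)) m) := dist_nonneg
      have hn' := hn
      unfold Between at hn'
      have e1 := hf (dist a y - n * translationLength τ) (-n)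
      have e2 := hf (dist a y - n * translationLength τ) n
      push_cast at e1 e2
      rw [abs_of_nonneg (by linarith)] at e1
      rw [abs_of_nonpos (by linarith), dist_comm] at e2
      refine ⟨dist a y - n * translationLength τ, h.eq_of_between ?_ hn ?_⟩
      · unfold Between; linarith
      · linarith

end Tree

/-! ### Products of isometries and displacements -/

section TreeAction

variable {X : Type*} [MetricSpace X]

/-- If the segment from `x` to `y` begins in the direction of `p`, and `e` lies in another direction
from `x`, then `y` and `e` lie in different directions. -/
theorem FourPoint.between_of_direction (h : FourPoint X 0) {x p y e : X} (hp : Between x p y)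
    (hpx : p ≠ x) (he : Between p x e) : Between y x e := by
  have := h.dist_chain he.symm hp hpx.symm
  unfold Between at *
  have := dist_comm e x
  have := dist_comm e y
  have := dist_comm x y
  linarith

/-- If the segments from `x` to `k x` and from `k x` to `k u x`, as well as the translates of this
path by `k u`, fit together without backtracking, then `x` lies on the axis of `k u`. -/
theorem FourPoint.translationLength_mul (h : FourPoint X 0) (hX : HasInterpolation X)
    {k u : X ≃ᵢ X} {x : X} (hk : k x ≠ x) (hu : u x ≠ x) (h1 : Between (k⁻¹ x) x (u x))
    (h2 : Between (k x) x (u⁻¹ x)) :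
    translationLength (k * u) = dist x (k x) + dist x (u x) := by
  have e1 : Between x (k x) (k (u x)) := by
    simpa [IsometryEquiv.apply_inv_self] using h1.map k
  have e2 : Between (k x) (k (u x)) (k (u (k x))) := by
    simpa [IsometryEquiv.apply_inv_self] using (h2.symm.map u).map k
  have e3 : Between (k (u x)) (k (u (k x))) (k (u (k (u x)))) := (e1.map u).map k
  have c1 := h.dist_chain e1 e2 (fun e => hu (k.injective e).symm)
  have e4 : Between x (k (u x)) (k (u (k x))) := by
    unfold Between at *; linarith
  have c2 := h.dist_chain e4 e3 (fun e => hk (u.injective (k.injective e)).symm)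
  have t := h.translationLength_eq hX (k * u) x
  simp only [IsometryEquiv.mul_apply] at t
  unfold Between at e1
  simp only [k.dist_eq, u.dist_eq] at c1 c2 e1
  have d1 := dist_pos.2 hk
  have d2 := dist_pos.2 hu
  rw [dist_comm] at d1 d2
  rw [t, max_eq_right] <;> linarith

theorem FourPoint.translationLength_eq_dist (h : FourPoint X 0) (hX : HasInterpolation X)
    {u : X ≃ᵢ X} {x : X} (h1 : Between (u x) x (u⁻¹ x)) : translationLength u = dist x (u x) := by
  have t := h.translationLength_eq hX u x
  have e := h1.map u
  unfold Between at e
  rw [IsometryEquiv.apply_inv_self, u.dist_eq, dist_comm (u x) x, dist_comm (u (u x))] at e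
  rw [t, ← e, max_eq_right] <;> linarith [dist_nonneg (x := x) (y := u x)]

/-- If a group acts on a tree without hyperbolic elements, then the maximal displacement by a finite
set of its elements is not minimal at a point `x` which they do not all fix: the segments from `x`
to its images begin in a common direction (otherwise a product of two of the elements would be
hyperbolic), and moving `x` in this direction reduces the displacements. -/
theorem FourPoint.exists_displacement_lt (h : FourPoint X 0) (hX : HasInterpolation X)
    {G : Type*} [Group G] (ρ : G →* (X ≃ᵢ X)) (hρ : ∀ g, translationLength (ρ g) = 0)
    (S : Finset G) (x : X) {r : ℝ} (hr : 0 < r) (hx : ∀ α ∈ S, dist x (ρ α x) ≤ r) :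
    ∃ y, ∀ α ∈ S, dist y (ρ α y) < r := by
  by_cases hfix : ∀ α ∈ S, ρ α x = x
  · exact ⟨x, fun α hα => by rwa [hfix α hα, dist_self]⟩
  push Not at hfix
  obtain ⟨β, hβ, hβx⟩ := hfix
  have sq (α : G) : dist x (ρ α (ρ α x)) ≤ dist x (ρ α x) := by
    have e := h.translationLength_eq hX (ρ α) x
    rw [hρ] at e
    linarith [le_max_right 0 (dist x (ρ α (ρ α x)) - dist x (ρ α x))]
  have ell (α : G) (hα : ρ α x ≠ x) : ¬ Between (ρ α x) x ((ρ α)⁻¹ x) := by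
    intro hb
    have := h.translationLength_eq_dist hX hb
    rw [hρ] at this
    exact hα (dist_eq_zero.1 this.symm).symm
  have dir (α : G) (hα : ρ α x ≠ x) : ¬ Between (ρ α x) x (ρ β x) := by
    intro hb
    have h1 := (h.between_or hb ((ρ α)⁻¹ x)).resolve_left (ell α hα)
    have h2 := (h.between_or hb ((ρ β)⁻¹ x)).resolve_right (fun h' => ell β hβx h'.symm)
    have e := h.translationLength_mul hX hα hβx h1 h2
    rw [← map_mul, hρ] at e
    have := dist_pos.2 hα
    have := dist_comm x (ρ α x)
    linarith [dist_nonneg (x := x) (y := ρ β x)]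
  have small (c : ℝ) (hc : 0 < c) : ∀ᶠ ε in 𝓝[>] (0 : ℝ), 2 * ε < c := by
    filter_upwards [Ioo_mem_nhdsGT (half_pos hc)] with ε hε
    linarith [hε.2]
  have ev : ∀ᶠ ε in 𝓝[>] (0 : ℝ), 0 < ε ∧ 2 * ε < r ∧ 2 * ε < dist x (ρ β x) ∧
      ∀ α ∈ S, ρ α x ≠ x → 2 * ε < dist x (ρ α x) ∧
        2 * ε < dist x (ρ α x) + dist x (ρ β x) - dist (ρ α x) (ρ β x) := by
    refine eventually_mem_nhdsWithin.and ((small r hr).and ((small _ (dist_pos.2 hβx.symm)).and ?_))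
    refine (Filter.eventually_all_finset S).2 fun α _ => ?_
    by_cases hα : ρ α x = x
    · simp [hα]
    · have := (dist_triangle (ρ α x) x (ρ β x)).lt_of_ne fun e => dir α hα e.symm
      have := dist_comm x (ρ α x)
      filter_upwards [small _ (dist_pos.2 (Ne.symm hα)),
        small (dist x (ρ α x) + dist x (ρ β x) - dist (ρ α x) (ρ β x)) (by linarith)]
        with ε h1 h2 _ using ⟨h1, h2⟩
  obtain ⟨ε, hε, hεr, hεβ, hεS⟩ := ev.exists
  obtain ⟨y, hy1, hy2⟩ := hX x (ρ β x) ε hε.le (by linarith)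
  have hy : Between x y (ρ β x) := by unfold Between; linarith
  refine ⟨y, fun α hα => ?_⟩
  by_cases hαx : ρ α x = x
  · have t := dist_triangle y x (ρ α y)
    have e := (ρ α).dist_eq x y
    rw [hαx] at e
    rw [dist_comm y x] at t
    linarith
  · obtain ⟨h1, h2⟩ := hεS α hα hαx
    have h3 : dist y (ρ α x) ≤ dist x (ρ α x) - ε := by
      refine (h.dist_le hy (ρ α x)).trans ?_
      rw [add_zero]
      refine max_le (by linarith) ?_
      have := dist_comm (ρ α x) (ρ β x)
      linarith
    have t1 := dist_triangle x y (ρ α x)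
    have hy' : Between x y (ρ α x) := by unfold Between; linarith
    have h4 : dist y (ρ α (ρ α x)) ≤ dist x (ρ α x) - ε := by
      refine (h.dist_le hy' _).trans ?_
      rw [add_zero, (ρ α).dist_eq]
      exact max_le (by linarith [sq α]) (by linarith)
    have h5 := h.dist_le (hy'.map (ρ α)) y
    rw [add_zero, (ρ α).dist_eq, (ρ α).dist_eq, dist_comm _ y, dist_comm _ y, dist_comm _ y] at h5
    have := dist_comm y x
    have := dist_comm y (ρ α (ρ α x))
    exact (h5.trans (max_le (by linarith) (by linarith))).trans_lt
      (show dist x (ρ α x) - 2 * ε < r by linarith [hx α hα])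

/-! ### The hull of an orbit -/

/-- Closed convex subsets of a tree have nearest-point projections. -/
theorem FourPoint.exists_projection (h : FourPoint X 0) (hX : HasInterpolation X) {C : Set X}
    (hC : IsClosed C) (hconv : ∀ x ∈ C, ∀ y ∈ C, ∀ p, Between x p y → p ∈ C) (hne : C.Nonempty)
    (z : X) : ∃ p ∈ C, ∀ y ∈ C, Between z p y := by
  obtain ⟨y₀, hy₀⟩ := hne
  by_cases hz : z = y₀
  · exact ⟨z, hz ▸ hy₀, fun y _ => by unfold Between; simp⟩
  obtain ⟨s, -, hs, -⟩ := h.isRTree hX z y₀ hz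
  obtain ⟨p, ⟨hps, hpC⟩, hmin⟩ := (hs.isCompact.inter_right hC).exists_isMinOn
    ⟨y₀, hs.right_mem, hy₀⟩ (f := fun p => dist z p) (by fun_prop)
  refine ⟨p, hpC, fun y hy => ?_⟩
  have t1 := dist_triangle z p y
  have t2 := dist_triangle p z y
  have t3 := dist_triangle z y p
  have c1 := dist_comm z p
  have c2 := dist_comm y p
  -- The centre `c` of the triangle `z`, `p`, `y` lies in `C` and between `z` and `p`.
  obtain ⟨c, hc1, hc2⟩ := hX p y ((dist z p + dist p y - dist z y) / 2) (by linarith) (by linarith)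
  have hc : Between p c y := by unfold Between; linarith
  have hcz : dist c z ≤ dist z p - dist p c := by
    refine (h.dist_le hc z).trans ?_
    rw [add_zero]
    refine max_le (by linarith) ?_
    have := dist_comm y z
    linarith
  have t4 := dist_triangle z c p
  have c3 := dist_comm z c
  have c4 := dist_comm c p
  have hzc : Between z c p := by unfold Between; linarith
  have hcs : c ∈ s := h.mem_of_isPreconnected hs.isPreconnected hs.left_mem hs.right_mem
    (hzc.trans_left (hs.between hps))
  have hle : dist z p ≤ dist z c := hmin ⟨hcs, hconv p hpC y hy c hc⟩
  unfold Between
  linarith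

variable {G : Type*} [Group G]

theorem dist_orbit (ρ : G →* (X ≃ᵢ X)) (x : X) (g k : G) :
    dist (ρ g x) (ρ k x) = dist x (ρ (g⁻¹ * k) x) := by
  rw [← (ρ g).dist_eq x, ← IsometryEquiv.mul_apply, ← map_mul, mul_inv_cancel_left]

/-- The convex hull of the orbit of `x`. -/
def orbitHull (ρ : G →* (X ≃ᵢ X)) (x : X) : Set X :=
  {y | ∃ g k : G, Between (ρ g x) y (ρ k x)}

theorem mem_orbitHull_orbit (ρ : G →* (X ≃ᵢ X)) (x : X) (g : G) : ρ g x ∈ orbitHull ρ x :=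
  ⟨g, g, by unfold Between; simp⟩

theorem self_mem_orbitHull (ρ : G →* (X ≃ᵢ X)) (x : X) : x ∈ orbitHull ρ x := by
  simpa using mem_orbitHull_orbit ρ x 1

theorem FourPoint.mem_orbitHull_iff (h : FourPoint X 0) {ρ : G →* (X ≃ᵢ X)} {x y : X} :
    y ∈ orbitHull ρ x ↔ ∃ g : G, Between x y (ρ g x) := by
  constructor
  · rintro ⟨g, k, hy⟩
    rcases h.between_or hy x with h' | h'
    · exact ⟨g, h'.symm⟩
    · exact ⟨k, h'⟩
  · rintro ⟨g, hy⟩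
    exact ⟨1, g, by simpa using hy⟩

theorem FourPoint.orbitHull_convex (h : FourPoint X 0) {ρ : G →* (X ≃ᵢ X)} {x y z p : X}
    (hy : y ∈ orbitHull ρ x) (hz : z ∈ orbitHull ρ x) (hp : Between y p z) :
    p ∈ orbitHull ρ x := by
  obtain ⟨g, hg⟩ := h.mem_orbitHull_iff.1 hy
  obtain ⟨k, hk⟩ := h.mem_orbitHull_iff.1 hz
  rcases h.between_or hp x with h' | h'
  · exact h.mem_orbitHull_iff.2 ⟨g, h'.symm.trans_left hg⟩
  · exact h.mem_orbitHull_iff.2 ⟨k, h'.trans_left hk⟩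

theorem FourPoint.isInvariantSubtree_orbitHull (h : FourPoint X 0) (hX : HasInterpolation X)
    (ρ : G →* (X ≃ᵢ X)) (x : X) : IsInvariantSubtree ρ (orbitHull ρ x) := by
  refine ⟨⟨⟨x, self_mem_orbitHull ρ x⟩, isPreconnected_of_forall_pair fun y hy z hz => ?_⟩, ?_⟩
  · by_cases hyz : y = z
    · subst hyz
      exact ⟨{y}, by simpa using hy, rfl, rfl, isPreconnected_singleton⟩
    · obtain ⟨s, -, hs, -⟩ := h.isRTree hX y z hyz
      exact ⟨s, fun p hp => h.orbitHull_convex hy hz (hs.between hp), hs.left_mem, hs.right_mem,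
        hs.isPreconnected⟩
  · have sub (g : G) : ρ g '' orbitHull ρ x ⊆ orbitHull ρ x := by
      rintro _ ⟨y, ⟨k, l, hy⟩, rfl⟩
      refine ⟨g * k, g * l, ?_⟩
      simpa using hy.map (ρ g)
    intro g
    refine (sub g).antisymm fun y hy => ⟨ρ g⁻¹ y, sub g⁻¹ ⟨y, hy, rfl⟩, ?_⟩
    rw [map_inv, IsometryEquiv.apply_inv_self]

/-- The hull of the orbit of a point on an axis is contained in every invariant subtree. -/
theorem FourPoint.orbitHull_subset (h : FourPoint X 0) (hX : HasInterpolation X)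
    {ρ : G →* (X ≃ᵢ X)} {g : G} (hg : 0 < translationLength (ρ g)) {x : X} (hx : x ∈ core (ρ g))
    {T : Set X} (hT : IsInvariantSubtree ρ T) : orbitHull ρ x ⊆ T := by
  have inv (k : G) {y : X} (hy : y ∈ T) : ρ k y ∈ T := by
    rw [← hT.2 k]; exact ⟨y, hy, rfl⟩
  have hxT : x ∈ T := by
    obtain ⟨y, hy⟩ := hT.1.nonempty
    obtain ⟨n, hn⟩ := h.exists_between_zpow hX hg hx y
    rw [← map_zpow, ← map_zpow] at hn
    exact h.mem_of_isPreconnected hT.1.isPreconnected (inv _ hy) (inv _ hy) hn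
  rintro y ⟨k, l, hy⟩
  exact h.mem_of_isPreconnected hT.1.isPreconnected (inv _ hxT) (inv _ hxT) hy

theorem FourPoint.iInf_dist_invariantSubtree (h : FourPoint X 0) (hX : HasInterpolation X)
    {ρ : G →* (X ≃ᵢ X)} {T : Set X} (hT : IsInvariantSubtree ρ T) (g : G) :
    ⨅ y : T, dist (y : X) (ρ g y) = lengthFunction ρ g := by
  obtain ⟨y, hy⟩ := hT.1.nonempty
  obtain ⟨m, hm, hym⟩ := h.exists_mem_core hX (ρ g) y
  have hgy : ρ g y ∈ T := by rw [← hT.2 g]; exact ⟨y, hy, rfl⟩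
  have hmT := h.mem_of_isPreconnected hT.1.isPreconnected hy hgy hym
  have : Nonempty T := ⟨⟨y, hy⟩⟩
  refine le_antisymm ?_ (le_ciInf fun y => translationLength_le_dist _ _)
  exact (ciInf_le ⟨0, by rintro _ ⟨y, rfl⟩; exact dist_nonneg⟩ (⟨m, hmT⟩ : T)).trans_eq hm

theorem FourPoint.isRTree_subtype (h : FourPoint X 0) (hX : HasInterpolation X) {T : Set X}
    (hT : IsPreconnected T) : IsRTree T := by
  have h' : FourPoint T 0 := fun x y z w => h x y z w
  refine h'.isRTree fun a b u h0 h1 => ?_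
  obtain ⟨p, hp1, hp2⟩ := hX a b u h0 h1
  have hp : Between (a : X) p b := by
    unfold Between; linarith
  exact ⟨⟨p, h.mem_of_isPreconnected hT a.2 b.2 hp⟩, hp1, hp2⟩

/-- A real number is a half-integer if its double is an integer. -/
def IsHalfInteger (r : ℝ) : Prop := ∃ n : ℤ, 2 * r = n

theorem IsHalfInteger.sub {r s : ℝ} (hr : IsHalfInteger r) (hs : IsHalfInteger s) :
    IsHalfInteger (r - s) := by
  obtain ⟨m, hm⟩ := hr
  obtain ⟨n, hn⟩ := hs
  exact ⟨m - n, by push_cast; linarith⟩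

theorem IsHalfInteger.max {r s : ℝ} (hr : IsHalfInteger r) (hs : IsHalfInteger s) :
    IsHalfInteger (max r s) := by
  rcases max_choice r s with e | e <;> rw [e] <;> assumption

theorem isHalfInteger_of_int {r : ℝ} (h : ∃ n : ℤ, r = n) : IsHalfInteger r := by
  obtain ⟨n, rfl⟩ := h
  exact ⟨2 * n, by push_cast; rfl⟩

theorem FourPoint.dist_eq_max (h : FourPoint X 0) {a p b : X} (hp : Between a p b) (c : X) :
    dist p c = max (dist a c - dist a p) (dist b c - dist p b) :=
  le_antisymm (by simpa using h.dist_le hp c) (le_dist_of_between c)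

/-- If the distances in the orbit of `x` are integers, then the hull of the orbit is a simplicial
tree with edges of length `1 / 2`: the vertices are the points at half-integral distance
from `x`. -/
theorem FourPoint.isMetricSimplicialTree_orbitHull (h : FourPoint X 0) (hX : HasInterpolation X)
    {ρ : G →* (X ≃ᵢ X)} {x : X} (hint : ∀ k, ∃ n : ℤ, dist x (ρ k x) = n) :
    IsMetricSimplicialTree (orbitHull ρ x) := by
  have hint2 (g k : G) : ∃ n : ℤ, dist (ρ g x) (ρ k x) = n := by
    rw [dist_orbit]
    exact hint _
  have half {y z : X} (hy : y ∈ orbitHull ρ x) (hz : z ∈ orbitHull ρ x)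
      (hy' : IsHalfInteger (dist x y)) (hz' : IsHalfInteger (dist x z)) :
      IsHalfInteger (dist y z) := by
    obtain ⟨g, hg⟩ := h.mem_orbitHull_iff.1 hy
    obtain ⟨k, hk⟩ := h.mem_orbitHull_iff.1 hz
    have e1 : dist y (ρ g x) = dist x (ρ g x) - dist x y := by unfold Between at hg; linarith
    have e2 : dist z (ρ k x) = dist x (ρ k x) - dist x z := by unfold Between at hk; linarith
    rw [h.dist_eq_max hg z, e1, dist_comm (ρ g x) z, h.dist_eq_max hk (ρ g x), e2]
    have i1 := isHalfInteger_of_int (hint g)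
    have i2 := isHalfInteger_of_int (hint k)
    have i3 := isHalfInteger_of_int (hint2 k g)
    exact (hz'.sub hy').max (((i1.sub hz').max (i3.sub (i2.sub hz'))).sub (i1.sub hy'))
  have sep {y z : X} (hy : y ∈ orbitHull ρ x) (hz : z ∈ orbitHull ρ x)
      (hy' : IsHalfInteger (dist x y)) (hz' : IsHalfInteger (dist x z))
      (hyz : dist y z < 1 / 2) : y = z := by
    obtain ⟨n, hn⟩ := half hy hz hy' hz'
    have h1 : (n : ℝ) < 1 := by linarith
    have h0 : (0 : ℝ) ≤ n := by rw [← hn]; positivity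
    have : n = 0 := by
      have : n < 1 := by exact_mod_cast h1
      have : 0 ≤ n := by exact_mod_cast h0
      omega
    rw [this] at hn
    rw [← dist_eq_zero]
    simpa using hn
  refine ⟨h.isRTree_subtype hX (h.isInvariantSubtree_orbitHull hX ρ x).1.isPreconnected,
    {y | IsHalfInteger (dist x y)}, ⟨⟨x, self_mem_orbitHull ρ x⟩, 0, by simp⟩, ?_, ?_⟩
  · intro y
    by_cases hv : ∃ v : orbitHull ρ x, IsHalfInteger (dist x v) ∧ v ≠ y ∧ dist y v < 1 / 4
    · obtain ⟨v, hv, hvy, hd⟩ := hv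
      refine ⟨dist y v, dist_pos.2 hvy.symm, fun v' hv' hd' => ?_⟩
      have t := dist_triangle v y v'
      rw [dist_comm v y] at t
      have e : v = v' := Subtype.ext (sep v.2 v'.2 hv hv' (by
        change dist v v' < 1 / 2
        linarith))
      exact absurd hd' (by rw [e]; exact lt_irrefl _)
    · push Not at hv
      refine ⟨1 / 4, by norm_num, fun v hv' hd => ?_⟩
      by_contra hne
      exact absurd hd (not_lt.2 (hv v hv' hne))
  · rintro ⟨y, hyT⟩ hyV
    obtain ⟨g, hg⟩ := h.mem_orbitHull_iff.1 hyT
    obtain ⟨N, hN⟩ := hint g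
    set s := dist x y with hs
    have hs0 : 0 ≤ s := dist_nonneg
    have hyV' : ¬ IsHalfInteger s := hyV
    set n := ⌊2 * s⌋ with hn
    have hn0 : 0 ≤ n := Int.floor_nonneg.2 (by linarith)
    have hn0' : (0 : ℝ) ≤ n := by exact_mod_cast hn0
    have hns : (n : ℝ) < 2 * s := (Int.floor_le _).lt_of_ne fun e => hyV' ⟨n, e.symm⟩
    have hns' : 2 * s < n + 1 := Int.lt_floor_add_one _
    have hsN : s ≤ N := by
      unfold Between at hg
      have : 0 ≤ dist y (ρ g x) := dist_nonneg
      linarith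
    have hnN : (n : ℝ) + 1 ≤ 2 * N := by
      have : (n : ℝ) < 2 * N := by linarith
      have : n < 2 * N := by exact_mod_cast this
      exact_mod_cast (by omega : n + 1 ≤ 2 * N)
    obtain ⟨v, hv1, hv2⟩ := hX x (ρ g x) (n / 2) (by linarith) (by linarith)
    obtain ⟨w, hw1, hw2⟩ := hX x (ρ g x) ((n + 1) / 2) (by linarith) (by linarith)
    have hv : Between x v (ρ g x) := by unfold Between; linarith
    have hw : Between x w (ρ g x) := by unfold Between; linarith
    have dvw : dist v w = 1 / 2 := by
      rw [h.dist_eq_abs hv hw, hv1, hw1, abs_of_nonpos (by linarith)]; ring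
    have dvy : dist v y = s - n / 2 := by
      rw [h.dist_eq_abs hv hg, hv1, abs_of_nonpos (by linarith)]; ring
    have dyw : dist y w = (n + 1) / 2 - s := by
      rw [h.dist_eq_abs hg hw, hw1, abs_of_nonpos (by linarith)]; ring
    -- Points of the open edge lie on the segment from `x` to `g x` between `v` and `w`.
    have arc {z : X} (hz : dist v z + dist z w = dist v w) :
        Between x z (ρ g x) ∧ dist x z = n / 2 + dist v z := by
      have hxz : Between x z w :=
        Between.trans_right (b := v) hz (by unfold Between; linarith)
      refine ⟨hxz.trans_left hw, ?_⟩
      unfold Between at hxz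
      linarith
    have hvT := h.mem_orbitHull_iff.2 ⟨g, hv⟩
    have hwT := h.mem_orbitHull_iff.2 ⟨g, hw⟩
    refine ⟨⟨v, hvT⟩, ⟨n, show 2 * dist x v = n by linarith⟩, ⟨w, hwT⟩,
      ⟨n + 1, show 2 * dist x w = _ by push_cast; linarith⟩, ?_, ⟨?_, ?_, ?_⟩, ?_, ?_⟩
    · intro e
      have e' : v = w := congrArg Subtype.val e
      rw [e', dist_self] at dvw
      norm_num at dvw
    · change dist v y + dist y w = dist v w
      linarith
    · intro e
      have e' : y = v := congrArg Subtype.val e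
      rw [e', dist_self] at dvy
      linarith
    · intro e
      have e' : y = w := congrArg Subtype.val e
      rw [e', dist_self] at dyw
      linarith
    · rw [Set.disjoint_left]
      rintro ⟨z, hzT⟩ ⟨hz, hzv, hzw⟩ ⟨k, hk⟩
      replace hz : dist v z + dist z w = dist v w := hz
      replace hk : 2 * dist x z = k := hk
      have d1 : 0 < dist v z := dist_pos.2 fun e => hzv (Subtype.ext e.symm)
      have d2 : 0 < dist z w := dist_pos.2 fun e => hzw (Subtype.ext e)
      have d3 := (arc hz).2
      have k1 : (n : ℝ) < k := by linarith
      have k2 : (k : ℝ) < n + 1 := by linarith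
      have k1' : n < k := by exact_mod_cast k1
      have k2' : k < n + 1 := by exact_mod_cast k2
      omega
    · refine Metric.isOpen_iff.2 ?_
      rintro ⟨z, hzT⟩ ⟨hz, hzv, hzw⟩
      replace hz : dist v z + dist z w = dist v w := hz
      have d1 : 0 < dist v z := dist_pos.2 fun e => hzv (Subtype.ext e.symm)
      have d2 : 0 < dist z w := dist_pos.2 fun e => hzw (Subtype.ext e)
      obtain ⟨hzg, hxz⟩ := arc hz
      refine ⟨min (dist v z) (dist z w), lt_min d1 d2, ?_⟩
      rintro ⟨z', hzT'⟩ hz'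
      replace hz' : dist z' z < min (dist v z) (dist z w) := hz'
      rw [lt_min_iff, dist_comm] at hz'
      obtain ⟨hz1, hz2⟩ := hz'
      have hne : z' ≠ v ∧ z' ≠ w := by
        constructor
        · rintro rfl; rw [dist_comm] at hz1; exact lt_irrefl _ hz1
        · rintro rfl; exact lt_irrefl _ hz2
      refine ⟨?_, fun e => hne.1 (congrArg Subtype.val e), fun e => hne.2 (congrArg Subtype.val e)⟩
      change dist v z' + dist z' w = dist v w
      obtain ⟨k, hk⟩ := h.mem_orbitHull_iff.1 hzT'
      have t1 := dist_triangle x z z'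
      have t2 := dist_triangle x z' z
      rw [dist_comm z' z] at t2
      have e1 := h.dist_eq_max hk (ρ g x)
      -- The segments from `x` to `g x` and to `k x` branch at a half-integral distance, hence not
      -- inside the open edge.
      rcases le_total (dist (ρ k x) (ρ g x) - dist z' (ρ k x)) (dist x (ρ g x) - dist x z')
        with hle | hle
      · rw [max_eq_left hle] at e1
        have hz'g : Between x z' (ρ g x) := by unfold Between; linarith
        rw [h.dist_eq_abs hv hz'g, h.dist_eq_abs hz'g hw, hv1, hw1,
          abs_of_nonpos (by linarith), abs_of_nonpos (by linarith), dvw]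
        ring
      · exfalso
        rw [max_eq_right hle] at e1
        have e2 := le_max_right (dist x z' - dist x z) (dist (ρ g x) z' - dist z (ρ g x))
        rw [← h.dist_eq_max hzg z', dist_comm (ρ g x) z', e1] at e2
        obtain ⟨K, hK⟩ := hint k
        obtain ⟨M, hM⟩ := hint2 k g
        unfold Between at hk hzg
        rcases lt_or_ge n (N + K - M) with hc | hc
        · have hc' : (n : ℝ) + 1 ≤ N + K - M := by exact_mod_cast hc
          linarith
        · have hc' : (N : ℝ) + K - M ≤ n := by exact_mod_cast hc
          linarith

/-! ### Integral length functions -/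

theorem map_mem_core {τ : X ≃ᵢ X} {x : X} (hx : x ∈ core τ) : τ x ∈ core τ := by
  rw [mem_core_iff] at *
  rwa [τ.dist_eq]

theorem inv_map_mem_core {τ : X ≃ᵢ X} {x : X} (hx : x ∈ core τ) : τ⁻¹ x ∈ core τ := by
  rw [mem_core_iff] at *
  rwa [IsometryEquiv.apply_inv_self, ← τ.dist_eq, IsometryEquiv.apply_inv_self]

theorem FourPoint.between_map_of_between (h : FourPoint X 0) {τ : X ≃ᵢ X} {p q : X}
    (h1 : Between p q (τ q)) (h2 : Between p q (τ⁻¹ q)) (hq : q ≠ τ q) : Between p q (τ p) := by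
  have h3 : Between q (τ q) (τ p) := by
    simpa [IsometryEquiv.apply_inv_self] using h2.symm.map τ
  have := h.dist_chain h1 h3 hq
  unfold Between at *
  linarith

/-- If a tripod is formed by three segments issuing from `x` and, for any two of its legs, there is
an element `u` such that `u x` and `u⁻¹ x` lie in the directions of these legs, then integrality of
the length function implies integrality of the distances in the orbit of `x`: for `k x ≠ x` one can
choose `u` with `L(k u) = d(x, k x) + d(x, u x)` and `L(u) = d(x, u x)`. -/
theorem FourPoint.dist_orbit_int (h : FourPoint X 0) (hX : HasInterpolation X)
    {ρ : G →* (X ≃ᵢ X)} (hint : ∀ g, ∃ m : ℤ, lengthFunction ρ g = m) {x p₁ p₂ p₃ : X}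
    (n₁ : p₁ ≠ x) (n₂ : p₂ ≠ x) (n₃ : p₃ ≠ x)
    (h₁₂ : Between p₁ x p₂) (h₁₃ : Between p₁ x p₃) (h₂₃ : Between p₂ x p₃)
    (u₁₂ : ∃ u, Between x p₁ (ρ u x) ∧ Between x p₂ (ρ u⁻¹ x))
    (u₁₃ : ∃ u, Between x p₁ (ρ u x) ∧ Between x p₃ (ρ u⁻¹ x))
    (u₂₃ : ∃ u, Between x p₂ (ρ u x) ∧ Between x p₃ (ρ u⁻¹ x)) (k : G) :
    ∃ n : ℤ, dist x (ρ k x) = n := by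
  by_cases hk : ρ k x = x
  · exact ⟨0, by rw [hk]; simp⟩
  have swap {p q : X} (hu : ∃ u, Between x p (ρ u x) ∧ Between x q (ρ u⁻¹ x)) :
      ∃ u, Between x q (ρ u x) ∧ Between x p (ρ u⁻¹ x) := by
    obtain ⟨u, h1, h2⟩ := hu
    exact ⟨u⁻¹, h2, by rwa [inv_inv]⟩
  have key {p q : X} (hp : p ≠ x) (hq : q ≠ x) (hpq : Between p x q)
      (hu : ∃ u, Between x p (ρ u x) ∧ Between x q (ρ u⁻¹ x))
      (hpk : Between p x ((ρ k)⁻¹ x)) (hqk : Between q x (ρ k x)) :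
      ∃ n : ℤ, dist x (ρ k x) = n := by
    obtain ⟨u, hu1, hu2⟩ := hu
    have a1 := h.between_of_direction hu1 hp hpk
    have a2 := h.between_of_direction hu2 hq hqk
    have a3 := h.between_of_direction hu2 hq (h.between_of_direction hu1 hp hpq).symm
    have hux : ρ u x ≠ x := fun e => by
      rw [e] at hu1
      unfold Between at hu1
      have := dist_pos.2 hp
      rw [dist_self, dist_comm] at hu1
      linarith
    rw [map_inv] at a2 a3
    obtain ⟨m, hm⟩ := hint (k * u)
    obtain ⟨m', hm'⟩ := hint u
    unfold lengthFunction at hm hm'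
    rw [map_mul, h.translationLength_mul hX hk hux a1.symm a2.symm] at hm
    rw [h.translationLength_eq_dist hX a3.symm] at hm'
    exact ⟨m - m', by push_cast; linarith⟩
  -- Each of the points `k x` and `k⁻¹ x` lies in the direction of at most one leg.
  have two (e : X) : (Between p₁ x e ∧ Between p₂ x e) ∨ (Between p₁ x e ∧ Between p₃ x e) ∨
      (Between p₂ x e ∧ Between p₃ x e) := by
    have a := (h.between_or h₁₂ e).imp_right Between.symm
    have b := (h.between_or h₁₃ e).imp_right Between.symm
    have c := (h.between_or h₂₃ e).imp_right Between.symm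
    tauto
  have k₁₂ := key n₁ n₂ h₁₂ u₁₂
  have k₁₃ := key n₁ n₃ h₁₃ u₁₃
  have k₂₃ := key n₂ n₃ h₂₃ u₂₃
  have k₂₁ := key n₂ n₁ h₁₂.symm (swap u₁₂)
  rcases two ((ρ k)⁻¹ x) with ⟨a, b⟩ | ⟨a, b⟩ | ⟨a, b⟩ <;>
  rcases two (ρ k x) with ⟨c, d⟩ | ⟨c, d⟩ | ⟨c, d⟩ <;>
  first
    | exact k₁₂ ‹_› ‹_› | exact k₁₃ ‹_› ‹_› | exact k₂₃ ‹_› ‹_›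
    | exact k₂₁ ‹_› ‹_›

/-- Let `x` be the endpoint, on the axis of `a`, of the segment connecting the disjoint axes of `a`
and `b`. Then the directions of the two halves of the axis of `a` and of the connecting segment form
a tripod at `x`, whose legs are joined by the axes of `a`, `a * b` and `a⁻¹ * b`. -/
theorem FourPoint.exists_integral_orbit (h : FourPoint X 0) (hX : HasInterpolation X)
    {ρ : G →* (X ≃ᵢ X)} (hint : ∀ g, ∃ m : ℤ, lengthFunction ρ g = m) {a b : G}
    (ha : IsHyperbolic (ρ a)) (hb : IsHyperbolic (ρ b))
    (hab : Disjoint (core (ρ a)) (core (ρ b))) :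
    ∃ x ∈ core (ρ a), ∀ k, ∃ n : ℤ, dist x (ρ k x) = n := by
  obtain ⟨ha0, fa, -, hfa⟩ := ha
  obtain ⟨hb0, fb, -, hfb⟩ := hb
  have hca : (core (ρ a)).Nonempty := hfa ▸ Set.range_nonempty fa
  have hcb : (core (ρ b)).Nonempty := hfb ▸ Set.range_nonempty fb
  obtain ⟨z, hz⟩ := hcb
  obtain ⟨x, hxa, hx⟩ := h.exists_projection hX (isClosed_core (ρ a))
    (fun _ h1 _ h2 _ => h.mem_core_of_between h1 h2) hca z
  obtain ⟨q, hqb, hq⟩ := h.exists_projection hX (isClosed_core (ρ b))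
    (fun _ h1 _ h2 _ => h.mem_core_of_between h1 h2) ⟨z, hz⟩ x
  refine ⟨x, hxa, ?_⟩
  have hqx : q ≠ x := fun e => Set.disjoint_left.1 hab hxa (e ▸ hqb)
  have moved {τ : X ≃ᵢ X} {y : X} (hτ : 0 < translationLength τ) (hy : y ∈ core τ) :
      τ y ≠ y ∧ τ⁻¹ y ≠ y := by
    have h1 : dist y (τ y) ≠ 0 := by rw [mem_core_iff.1 hy]; exact hτ.ne'
    have h2 : τ y ≠ y := fun e => h1 (by rw [e, dist_self])
    refine ⟨h2, fun e => h2 ?_⟩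
    conv_lhs => rw [← e]
    exact IsometryEquiv.apply_inv_self _ _
  obtain ⟨ma, ma'⟩ := moved ha0 hxa
  obtain ⟨mb, mb'⟩ := moved hb0 hqb
  have h₁₂ : Between (ρ a x) x ((ρ a)⁻¹ x) := by
    have e := h.dist_zpow_of_mem_core hX ha0 hxa 1 (-1)
    have e1 := h.dist_zpow_of_mem_core hX ha0 hxa 1 0
    have e2 := h.dist_zpow_of_mem_core hX ha0 hxa 0 (-1)
    norm_num at e e1 e2
    unfold Between
    linarith
  have leg {y : X} (hy : y ∈ core (ρ a)) : Between y x q := by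
    rcases h.between_or (hx y hy) q with h' | h'
    · exfalso
      have h2 := hq z hz
      unfold Between at h' h2
      have := dist_pos.2 hqx
      have := dist_comm q x
      have := dist_comm q z
      have := dist_comm x z
      linarith
    · exact h'.symm
  have h₁₃ := leg (map_mem_core hxa)
  have h₂₃ := leg (inv_map_mem_core hxa)
  have hqb1 := hq _ (map_mem_core hqb)
  have hqb2 := hq _ (inv_map_mem_core hqb)
  have b1 : Between x q (ρ b x) := h.between_map_of_between hqb1 hqb2 mb.symm
  have b2 : Between x q ((ρ b)⁻¹ x) :=
    h.between_map_of_between hqb2 (by rwa [inv_inv]) mb'.symm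
  have self (y : X) : Between x y y := by unfold Between; simp
  -- The element `c` stands for `a` and for `a⁻¹`.
  have join (c : G) (hc : Between (ρ c x) x q) (hc' : Between ((ρ c)⁻¹ x) x q) :
      ∃ u, Between x (ρ c x) (ρ u x) ∧ Between x q (ρ u⁻¹ x) := by
    refine ⟨c * b, ?_, ?_⟩
    · have := (h.between_of_direction b1 hqx hc'.symm).symm.map (ρ c)
      simpa [IsometryEquiv.apply_inv_self] using this
    · have := (h.between_of_direction b1 hqx hc'.symm).map (ρ b)⁻¹
      rw [IsometryEquiv.inv_apply_self] at this
      simpa using b2.trans_left this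
  refine h.dist_orbit_int hX hint ma ma' hqx h₁₂ h₁₃ h₂₃ ⟨a, self _, ?_⟩ (join a h₁₃ h₂₃) ?_
  · rw [map_inv]; exact self _
  · have := join a⁻¹ (by rwa [map_inv]) (by rwa [map_inv, inv_inv])
    rwa [map_inv] at this

end TreeAction

/-! ### The complete graph -/

section Graph

open CompleteGraph

variable {G : Type*}

theorem CompleteGraph.edgePoint_one (a b : G) : edgePoint a b 1 = vertex b := by
  ext g; simp [edgePoint, vertex]

theorem CompleteGraph.edgePoint_symm (a b : G) (t : unitInterval) :
    edgePoint b a (unitInterval.symm t) = edgePoint a b t := by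
  ext g; simp [edgePoint, add_comm]

theorem CompleteGraph.exists_eq_edgePoint (p : CompleteGraph G) :
    ∃ a b t, p = edgePoint a b t := by
  classical
  have hsum := p.sum_eq_one
  unfold Finsupp.sum at hsum
  have hcard := p.card_le_two
  have hz (g : G) (hg : g ∉ p.weight.support) : p.weight g = 0 := Finsupp.notMem_support_iff.1 hg
  obtain h | h | h : p.weight.support.card = 0 ∨ p.weight.support.card = 1 ∨
      p.weight.support.card = 2 := by omega
  · rw [Finset.card_eq_zero.1 h] at hsum
    simp at hsum
  · obtain ⟨a, ha⟩ := Finset.card_eq_one.1 h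
    rw [ha, Finset.sum_singleton] at hsum
    refine ⟨a, a, 0, ?_⟩
    ext g
    by_cases hg : g = a
    · subst hg; simpa [edgePoint] using hsum
    · rw [hz g (by rw [ha]; simpa using hg)]
      simp [edgePoint, Ne.symm hg]
  · obtain ⟨a, b, hab, ha⟩ := Finset.card_eq_two.1 h
    rw [ha, Finset.sum_pair hab] at hsum
    refine ⟨a, b, ⟨p.weight b, p.nonneg b, by linarith [p.nonneg a]⟩, ?_⟩
    ext g
    by_cases hg : g = a
    · subst hg; simp [edgePoint, hab.symm]; linarith
    by_cases hg' : g = b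
    · subst hg'; simp [edgePoint, hab]
    · rw [hz g (by rw [ha]; simp [hg, hg'])]
      simp [edgePoint, Ne.symm hg, Ne.symm hg']

theorem CompleteGraph.smul_vertex [Group G] (g a : G) : g • vertex a = vertex (g * a) := by
  classical
  ext k
  change (vertex a).weight (g⁻¹ * k) = (vertex (g * a)).weight k
  simp [vertex, edgePoint, Finsupp.single_apply, eq_inv_mul_iff_mul_eq]

variable {X : Type*} [MetricSpace X] {f : CompleteGraph G → X}

theorem IsStraight.dist_edgePoint (hf : IsStraight f) (a b : G) (t : unitInterval) :
    dist (f (edgePoint a b t)) (f (vertex b)) =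
      (1 - t) * dist (f (vertex a)) (f (vertex b)) := by
  rw [← edgePoint_symm, dist_comm, hf, unitInterval.coe_symm_eq, dist_comm (f (vertex a))]

theorem IsStraight.between (hf : IsStraight f) (a b : G) (t : unitInterval) :
    Between (f (vertex a)) (f (edgePoint a b t)) (f (vertex b)) := by
  unfold Between
  rw [hf.dist_edgePoint, hf]
  ring

end Graph

/-! ### Displacements -/

section Displacement

variable {X : Type*} [MetricSpace X] {G : Type*} [Group G]

theorem dist_le_maxDisplacement (ρ : G →* (X ≃ᵢ X)) {S : Finset G} (x : X) {α : G} (hα : α ∈ S) :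
    dist x (ρ α x) ≤ maxDisplacement ρ S x :=
  le_ciSup (f := fun α : S => dist x (ρ α x)) (Set.finite_range _).bddAbove ⟨α, hα⟩

theorem maxDisplacement_nonneg (ρ : G →* (X ≃ᵢ X)) (S : Finset G) (x : X) :
    0 ≤ maxDisplacement ρ S x :=
  Real.iSup_nonneg fun _ => dist_nonneg

theorem maxDisplacement_le (ρ : G →* (X ≃ᵢ X)) {S : Finset G} (x : X) {r : ℝ} (hr : 0 ≤ r)
    (h : ∀ α ∈ S, dist x (ρ α x) ≤ r) : maxDisplacement ρ S x ≤ r :=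
  Real.iSup_le (fun α => h α α.2) hr

/-- The displacement by `g` is bounded by the word length of `g` times the maximal displacement by
the generators. -/
theorem exists_dist_le_mul_maxDisplacement {S : Finset G}
    (hS : Subgroup.closure (S : Set G) = ⊤) {H : ℕ → Type*} [∀ n, MetricSpace (H n)]
    (ρ : ∀ n, G →* (H n ≃ᵢ H n)) (x : ∀ n, H n) (g : G) :
    ∃ C : ℝ, 0 ≤ C ∧ ∀ n, dist (x n) (ρ n g (x n)) ≤ C * maxDisplacement (ρ n) S (x n) := by
  have hg : g ∈ Subgroup.closure (S : Set G) := hS ▸ Subgroup.mem_top g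
  induction hg using Subgroup.closure_induction with
  | mem α hα =>
    exact ⟨1, zero_le_one, fun n => by rw [one_mul]; exact dist_le_maxDisplacement _ _ hα⟩
  | one => exact ⟨0, le_rfl, fun n => by simp⟩
  | mul g k _ _ hg hk =>
    obtain ⟨C, hC, hg⟩ := hg
    obtain ⟨C', hC', hk⟩ := hk
    refine ⟨C + C', add_nonneg hC hC', fun n => ?_⟩
    have t := dist_triangle (x n) (ρ n g (x n)) (ρ n (g * k) (x n))
    rw [dist_orbit, inv_mul_cancel_left] at t
    linarith [hg n, hk n]
  | inv g _ hg =>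
    obtain ⟨C, hC, hg⟩ := hg
    refine ⟨C, hC, fun n => ?_⟩
    have e := dist_orbit (ρ n) (x n) g 1
    rw [mul_one, map_one, dist_comm] at e
    rw [← e]
    exact hg n

theorem countable_of_closure_finset {S : Finset G} (hS : Subgroup.closure (S : Set G) = ⊤) :
    Countable G := by
  have : Group.FG G := ⟨⟨S, hS⟩⟩
  obtain ⟨_, _, f, hf⟩ := Group.fg_iff_exists_freeGroup_hom_surjective_finite.1 this
  exact hf.countable

end Displacement

/-! ### Rescaled limits -/

section Limit

open CompleteGraph

variable {G : Type*} {H : ℕ → Type*} [∀ n, MetricSpace (H n)]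

/-- In the rescaled limit, the distance from a point between `a` and `b` to `c` is determined by
the distances of `a`, `b` and `c`. -/
theorem tendsto_dist_of_between {C : ℝ} (h : ∀ n, FourPoint (H n) C) {lam : ℕ → ℝ}
    (hpos : ∀ n, 0 < lam n) (hlam : Tendsto lam atTop (𝓝 0)) {a p b c : ∀ n, H n}
    (hp : ∀ n, Between (a n) (p n) (b n)) {A B U V : ℝ}
    (hA : Tendsto (fun n => lam n * dist (a n) (c n)) atTop (𝓝 A))
    (hB : Tendsto (fun n => lam n * dist (b n) (c n)) atTop (𝓝 B))
    (hU : Tendsto (fun n => lam n * dist (a n) (p n)) atTop (𝓝 U))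
    (hV : Tendsto (fun n => lam n * dist (p n) (b n)) atTop (𝓝 V)) :
    Tendsto (fun n => lam n * dist (p n) (c n)) atTop (𝓝 (max (A - U) (B - V))) := by
  have hlow := (hA.sub hU).max (hB.sub hV)
  have hup := hlow.add (hlam.mul_const C)
  rw [zero_mul, add_zero] at hup
  refine tendsto_of_tendsto_of_tendsto_of_le_of_le hlow hup (fun n => ?_) (fun n => ?_)
  · have := mul_le_mul_of_nonneg_left
      (le_dist_of_between (a := a n) (p := p n) (b := b n) (c n)) (hpos n).le
    rwa [mul_max_of_nonneg _ _ (hpos n).le, mul_sub, mul_sub] at this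
  · have := mul_le_mul_of_nonneg_left ((h n).dist_le (hp n) (c n)) (hpos n).le
    rwa [mul_add, mul_max_of_nonneg _ _ (hpos n).le, mul_sub, mul_sub] at this

/-- Rescaled pull-backs of the metrics under straight maps converge on the whole graph as soon as
they converge on the vertices. -/
theorem exists_tendsto_dist {C : ℝ} (h : ∀ n, FourPoint (H n) C) {lam : ℕ → ℝ}
    (hpos : ∀ n, 0 < lam n) (hlam : Tendsto lam atTop (𝓝 0)) {ι : ∀ n, CompleteGraph G → H n}
    (hι : ∀ n, IsStraight (ι n))
    (hv : ∀ a b : G, ∃ l, Tendsto (fun n => lam n * dist (ι n (vertex a)) (ι n (vertex b))) atTop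
      (𝓝 l)) (p q : CompleteGraph G) :
    ∃ l, Tendsto (fun n => lam n * dist (ι n p) (ι n q)) atTop (𝓝 l) := by
  have hU (a b : G) (t : unitInterval) :
      ∃ l, Tendsto (fun n => lam n * dist (ι n (vertex a)) (ι n (edgePoint a b t))) atTop
        (𝓝 l) := by
    obtain ⟨l, hl⟩ := hv a b
    refine ⟨t * l, (hl.const_mul _).congr fun n => ?_⟩
    rw [hι n]
    ring
  have hV (a b : G) (t : unitInterval) :
      ∃ l, Tendsto (fun n => lam n * dist (ι n (edgePoint a b t)) (ι n (vertex b))) atTop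
        (𝓝 l) := by
    obtain ⟨l, hl⟩ := hv a b
    refine ⟨(1 - t) * l, (hl.const_mul _).congr fun n => ?_⟩
    rw [(hι n).dist_edgePoint]
    ring
  have step {c : CompleteGraph G} (hc : ∀ a : G, ∃ l,
      Tendsto (fun n => lam n * dist (ι n (vertex a)) (ι n c)) atTop (𝓝 l)) (p : CompleteGraph G) :
      ∃ l, Tendsto (fun n => lam n * dist (ι n p) (ι n c)) atTop (𝓝 l) := by
    obtain ⟨a, b, t, rfl⟩ := p.exists_eq_edgePoint
    obtain ⟨A, hA⟩ := hc a
    obtain ⟨B, hB⟩ := hc b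
    obtain ⟨U, hU⟩ := hU a b t
    obtain ⟨V, hV⟩ := hV a b t
    exact ⟨_, tendsto_dist_of_between h hpos hlam (fun n => (hι n).between a b t) hA hB hU hV⟩
  refine step (fun a => ?_) p
  obtain ⟨l, hl⟩ := step (fun b => hv b a) q
  exact ⟨l, by simpa only [dist_comm] using hl⟩

/-- Existence of rescaled limits: the metrics are divided by the displacement of the approximate
centres. A diagonal argument gives convergence on the countable set of vertices. -/
theorem exists_isRescaledLimit [Group G] {S : Finset G} (hS : Subgroup.closure (S : Set G) = ⊤) {C : ℝ}
    (h : ∀ n, FourPoint (H n) C) {ρ : ∀ n, G →* (H n ≃ᵢ H n)} (hρ : BlowsUp ρ) {x : ∀ n, H n}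
    {ι : ∀ n, CompleteGraph G → H n} (hstraight : ∀ n, IsStraight (ι n))
    (hι : ∀ n g, ι n (vertex g) = ρ n g (x n)) :
    ∃ (φ : ℕ → ℕ) (lam : ℕ → ℝ) (D : PseudoMetricSpace (CompleteGraph G)),
      IsRescaledLimit ι φ lam D := by
  have : Countable G := countable_of_closure_finset hS
  set r : ℕ → ℝ := fun n => maxDisplacement (ρ n) S (x n) with hr
  have hr0 (n : ℕ) : 0 ≤ r n := maxDisplacement_nonneg _ _ _
  choose K hK0 hK using exists_dist_le_mul_maxDisplacement hS ρ x
  have hrtop : Tendsto r atTop atTop := by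
    obtain ⟨α, hα⟩ := hρ
    have hpos : 0 < K α + 1 := by linarith [hK0 α]
    refine tendsto_atTop_mono (fun n => ?_) (hα.atTop_div_const hpos)
    rw [div_le_iff₀ hpos]
    have := (translationLength_le_dist (ρ n α) (x n)).trans (hK α n)
    linarith [hr0 n]
  set μ : ℕ → ℝ := fun n => (max 1 (r n))⁻¹ with hμ
  have hμpos (n : ℕ) : 0 < μ n := inv_pos.2 (lt_max_of_lt_left one_pos)
  have hμ0 : Tendsto μ atTop (𝓝 0) :=
    tendsto_inv_atTop_zero.comp (tendsto_atTop_mono (fun n => le_max_right 1 (r n)) hrtop)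
  have hμr (n : ℕ) : μ n * r n ≤ 1 := by
    rw [hμ, inv_mul_le_iff₀ (lt_max_of_lt_left one_pos), mul_one]
    exact le_max_right _ _
  have hdist (n : ℕ) (a b : G) :
      dist (ι n (vertex a)) (ι n (vertex b)) = dist (x n) (ρ n (a⁻¹ * b) (x n)) := by
    rw [hι, hι, dist_orbit]
  obtain ⟨E, -, φ, hφ, hE⟩ := (isCompact_univ_pi fun ab : G × G =>
      isCompact_Icc (a := (0 : ℝ)) (b := K (ab.1⁻¹ * ab.2))).tendsto_subseq
    (x := fun n ab => μ n * dist (ι n (vertex ab.1)) (ι n (vertex ab.2))) (by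
      intro n ab _
      refine ⟨mul_nonneg (hμpos n).le dist_nonneg, ?_⟩
      have e := mul_le_mul_of_nonneg_left (hK (ab.1⁻¹ * ab.2) n) (hμpos n).le
      have e' := mul_le_mul_of_nonneg_left (hμr n) (hK0 (ab.1⁻¹ * ab.2))
      change μ n * dist (ι n (vertex ab.1)) (ι n (vertex ab.2)) ≤ _
      rw [hdist]
      change _ ≤ μ n * (_ * r n) at e
      linarith)
  have hv (a b : G) : Tendsto (fun n => μ (φ n) * dist (ι (φ n) (vertex a)) (ι (φ n) (vertex b)))
      atTop (𝓝 (E (a, b))) := tendsto_pi_nhds.1 hE (a, b)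
  have hlam0 := hμ0.comp hφ.tendsto_atTop
  have key := exists_tendsto_dist (fun n => h (φ n)) (lam := fun n => μ (φ n))
    (fun n => hμpos (φ n)) hlam0 (fun n => hstraight (φ n)) (fun a b => ⟨_, hv a b⟩)
  choose D hD using key
  refine ⟨φ, fun n => μ (φ n),
    { dist := D
      dist_self := fun p => tendsto_nhds_unique (hD p p) (by simp)
      dist_comm := fun p q => tendsto_nhds_unique (hD p q) (by simpa only [dist_comm] using hD q p)
      dist_triangle := fun p q s => le_of_tendsto_of_tendsto' (hD p s) ((hD p q).add (hD q s))
        fun n => by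
          rw [← mul_add]
          exact mul_le_mul_of_nonneg_left (dist_triangle _ _ _) (hμpos _).le },
    hφ, fun n => hμpos _, hlam0, hD, ?_⟩
  by_contra! hzero
  have hsum : Tendsto (fun n => ∑ α ∈ S, μ (φ n) * dist (ι (φ n) (vertex 1)) (ι (φ n) (vertex α)))
      atTop (𝓝 (∑ _α ∈ S, 0)) :=
    tendsto_finsetSum S fun α _ => (hzero (vertex 1) (vertex α)) ▸ hD (vertex 1) (vertex α)
  rw [Finset.sum_const_zero] at hsum
  have hev : ∀ᶠ n in atTop, 1 ≤ ∑ α ∈ S,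
      μ (φ n) * dist (ι (φ n) (vertex 1)) (ι (φ n) (vertex α)) := by
    filter_upwards [(hrtop.comp hφ.tendsto_atTop).eventually_ge_atTop 1] with n hn
    have hn' : 1 ≤ r (φ n) := hn
    have e : μ (φ n) * r (φ n) = 1 := by
      simp only [hμ]
      rw [max_eq_right hn', inv_mul_cancel₀ (by linarith)]
    rw [← e, ← Finset.mul_sum]
    refine mul_le_mul_of_nonneg_left ?_ (hμpos _).le
    refine maxDisplacement_le _ _ (Finset.sum_nonneg fun _ _ => dist_nonneg) fun α hα => ?_
    have e' := Finset.single_le_sum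
      (f := fun α => dist (ι (φ n) (vertex 1)) (ι (φ n) (vertex α))) (fun _ _ => dist_nonneg) hα
    rwa [hdist (φ n) 1 α, inv_one, one_mul] at e'
  exact absurd (ge_of_tendsto hsum hev) (by norm_num)

end Limit

/-! ### The limit tree -/

section LimitTree

open CompleteGraph

theorem toAssociated_surjective {K : Type*} (D : PseudoMetricSpace K) :
    Function.Surjective (toAssociated D) :=
  @SeparationQuotient.surjective_mk K D.toUniformSpace.toTopologicalSpace

theorem toAssociated_eq_iff {K : Type*} (D : PseudoMetricSpace K) {p q : K} :
    toAssociated D p = toAssociated D q ↔ D.dist p q = 0 := by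
  rw [← dist_eq_zero, dist_toAssociated]

/-- An isometric action for a pseudo-metric descends to the associated metric space. -/
theorem exists_action_associated {K : Type*} (D : PseudoMetricSpace K) {G : Type*} [Group G]
    [MulAction G K] (hD : ∀ (g : G) (p q : K), D.dist (g • p) (g • q) = D.dist p q) :
    ∃ σ : G →* (AssociatedSpace D ≃ᵢ AssociatedSpace D),
      ∀ g p, σ g (toAssociated D p) = toAssociated D (g • p) := by
  have key (g : G) (y : AssociatedSpace D) :
      ∃ z, ∀ p, toAssociated D p = y → toAssociated D (g • p) = z := by
    obtain ⟨p, rfl⟩ := toAssociated_surjective D y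
    refine ⟨toAssociated D (g • p), fun q hq => ?_⟩
    rw [toAssociated_eq_iff] at hq ⊢
    rw [hD, hq]
  choose f hf using key
  have hf' (g : G) (p : K) : f g (toAssociated D p) = toAssociated D (g • p) := (hf g _ p rfl).symm
  have hcomp (g k : G) (y : AssociatedSpace D) : f g (f k y) = f (g * k) y := by
    obtain ⟨p, rfl⟩ := toAssociated_surjective D y
    rw [hf', hf', hf', mul_smul]
  have hone (y : AssociatedSpace D) : f 1 y = y := by
    obtain ⟨p, rfl⟩ := toAssociated_surjective D y
    rw [hf', one_smul]
  refine ⟨MonoidHom.mk' (fun g =>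
    { toFun := f g
      invFun := f g⁻¹
      left_inv := fun y => by rw [hcomp, inv_mul_cancel, hone]
      right_inv := fun y => by rw [hcomp, mul_inv_cancel, hone]
      isometry_toFun := Isometry.of_dist_eq fun y z => ?_ }) fun g k => ?_, hf'⟩
  · obtain ⟨p, rfl⟩ := toAssociated_surjective D y
    obtain ⟨q, rfl⟩ := toAssociated_surjective D z
    rw [hf', hf', dist_toAssociated, dist_toAssociated, hD]
  · ext y
    exact (hcomp g k y).symm

variable {G : Type*} {H : ℕ → Type*} [∀ n, MetricSpace (H n)]
  {ι : ∀ n, CompleteGraph G → H n} {φ : ℕ → ℕ} {lam : ℕ → ℝ}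
  {D : PseudoMetricSpace (CompleteGraph G)}

theorem IsRescaledLimit.fourPoint (hD : IsRescaledLimit ι φ lam D) {C : ℝ}
    (h : ∀ n, FourPoint (H n) C) : FourPoint (AssociatedSpace D) 0 := by
  intro x y z w
  obtain ⟨x, rfl⟩ := toAssociated_surjective D x
  obtain ⟨y, rfl⟩ := toAssociated_surjective D y
  obtain ⟨z, rfl⟩ := toAssociated_surjective D z
  obtain ⟨w, rfl⟩ := toAssociated_surjective D w
  simp only [dist_toAssociated]
  have T := hD.tendsto_dist
  have hC := hD.tendsto_zero.mul_const C
  rw [zero_mul] at hC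
  refine le_of_tendsto_of_tendsto' ((T x y).add (T z w))
    ((((T x z).add (T y w)).max ((T x w).add (T y z))).add hC) fun n => ?_
  simp only [← mul_add]
  rw [← mul_max_of_nonneg _ _ (hD.pos n).le, ← mul_add]
  exact mul_le_mul_of_nonneg_left (h (φ n) _ _ _ _) (hD.pos n).le

theorem IsRescaledLimit.isStraight (hD : IsRescaledLimit ι φ lam D)
    (hι : ∀ n, IsStraight (ι n)) : IsStraight (toAssociated D) := by
  intro a b t
  simp only [dist_toAssociated]
  refine tendsto_nhds_unique (hD.tendsto_dist _ _)
    (((hD.tendsto_dist (vertex a) (vertex b)).const_mul (t : ℝ)).congr fun n => ?_)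
  rw [hι]
  ring

/-- The limit is a geodesic space: the edges of the graph map onto segments, and any two points
are joined by a path of at most three pieces of edges. -/
theorem IsRescaledLimit.hasInterpolation (hD : IsRescaledLimit ι φ lam D)
    (h4 : FourPoint (AssociatedSpace D) 0) (hι : ∀ n, IsStraight (ι n)) :
    HasInterpolation (AssociatedSpace D) := by
  have hst := hD.isStraight hι
  have edge (a b : G) (t : unitInterval) :
      Interpolates (toAssociated D (vertex a)) (toAssociated D (edgePoint a b t)) := by
    intro u hu0 hu1
    rw [hst] at hu1 ⊢
    set L := dist (toAssociated D (vertex a)) (toAssociated D (vertex b)) with hL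
    have hL0 : 0 ≤ L := dist_nonneg
    rcases hL0.eq_or_lt with h0 | h0
    · rw [← h0, mul_zero] at hu1 ⊢
      have hu : u = 0 := le_antisymm hu1 hu0
      exact ⟨_, (dist_self _).trans hu.symm, by rw [hst, ← hL, ← h0, hu]; ring⟩
    · have hs : u / L ∈ Set.Icc (0 : ℝ) 1 :=
        ⟨div_nonneg hu0 hL0, (div_le_one h0).2 (hu1.trans (mul_le_of_le_one_left hL0 t.2.2))⟩
      have hsL : u / L * L = u := div_mul_cancel₀ _ h0.ne'
      refine ⟨toAssociated D (edgePoint a b ⟨u / L, hs⟩), by rw [hst, ← hL]; exact hsL, ?_⟩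
      rw [h4.dist_eq_abs (hst.between a b ⟨u / L, hs⟩) (hst.between a b t), hst, hst, ← hL]
      change |u / L * L - _| = _
      rw [hsL, abs_of_nonpos (by linarith), neg_sub]
  intro y z
  obtain ⟨p, rfl⟩ := toAssociated_surjective D y
  obtain ⟨q, rfl⟩ := toAssociated_surjective D z
  obtain ⟨a, b, t, rfl⟩ := p.exists_eq_edgePoint
  obtain ⟨c, d, s, rfl⟩ := q.exists_eq_edgePoint
  have hac := edge a c 1
  rw [edgePoint_one] at hac
  exact h4.interpolates_trans (h4.interpolates_trans (edge a b t).symm hac) (edge c d s)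

variable [Group G] {ρ : ∀ n, G →* (H n ≃ᵢ H n)}

theorem IsRescaledLimit.dist_smul (hD : IsRescaledLimit ι φ lam D)
    (hι : ∀ n, IsEquivariant (ρ n) (ι n)) (g : G) (p q : CompleteGraph G) :
    D.dist (g • p) (g • q) = D.dist p q := by
  refine tendsto_nhds_unique (hD.tendsto_dist _ _) ((hD.tendsto_dist p q).congr fun n => ?_)
  rw [hι, hι, (ρ (φ n) g).dist_eq]

/-- Translation lengths converge, since up to a bounded error they are determined by the
distances in an orbit. -/
theorem IsRescaledLimit.tendsto_lengthFunction (hD : IsRescaledLimit ι φ lam D) {C : ℝ}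
    (h : ∀ n, FourPoint (H n) C) (hH : ∀ n, HasInterpolation (H n))
    (h4 : FourPoint (AssociatedSpace D) 0) (hX : HasInterpolation (AssociatedSpace D))
    (hι : ∀ n, IsEquivariant (ρ n) (ι n)) {σ : G →* (AssociatedSpace D ≃ᵢ AssociatedSpace D)}
    (hσ : IsCoveredBy D σ) (g : G) :
    Tendsto (fun n => lam n * lengthFunction (ρ (φ n)) g) atTop (𝓝 (lengthFunction σ g)) := by
  unfold lengthFunction
  rw [h4.translationLength_eq hX (σ g) (toAssociated D (vertex 1)), hσ, hσ, dist_toAssociated,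
    dist_toAssociated]
  have T := hD.tendsto_dist
  have T1 := (tendsto_const_nhds (x := (0 : ℝ))).max
    ((T (vertex 1) (g • g • vertex 1)).sub (T (vertex 1) (g • vertex 1)))
  have T2 := T1.sub (hD.tendsto_zero.mul_const C)
  have T3 := T1.add (hD.tendsto_zero.mul_const (2 * C))
  rw [zero_mul, sub_zero] at T2
  rw [zero_mul, add_zero] at T3
  refine tendsto_of_tendsto_of_tendsto_of_le_of_le T2 T3 (fun n => ?_) (fun n => ?_)
  · have e1 := (h (φ n)).le_translationLength (ρ (φ n) g) (ι (φ n) (vertex 1))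
    have e2 := translationLength_nonneg (ρ (φ n) g)
    have hC : 0 ≤ C := by
      simpa using h (φ n) (ι (φ n) (vertex 1)) (ι (φ n) (vertex 1)) (ι (φ n) (vertex 1))
        (ι (φ n) (vertex 1))
    have e3 := mul_le_mul_of_nonneg_left
      (show max 0 (dist (ι (φ n) (vertex 1)) (ρ (φ n) g (ρ (φ n) g (ι (φ n) (vertex 1)))) -
        dist (ι (φ n) (vertex 1)) (ρ (φ n) g (ι (φ n) (vertex 1)))) - C ≤ _ from
        sub_le_iff_le_add.2 (max_le (by linarith) (sub_le_iff_le_add.1 e1))) (hD.pos n).le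
    rwa [mul_sub, mul_max_of_nonneg _ _ (hD.pos n).le, mul_sub, mul_zero, ← hι, ← hι] at e3
  · have e3 := mul_le_mul_of_nonneg_left ((h (φ n)).translationLength_le (hH (φ n))
      (ρ (φ n) g) (ι (φ n) (vertex 1))) (hD.pos n).le
    rwa [mul_add, mul_max_of_nonneg _ _ (hD.pos n).le, mul_sub, mul_zero, ← hι, ← hι] at e3

/-- The length function of the limit action does not vanish: otherwise all generators would be
displaced less at some point of the limit tree than at the limit of the approximate centres. -/
theorem IsRescaledLimit.exists_lengthFunction_pos (hD : IsRescaledLimit ι φ lam D)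
    {S : Finset G} (hS : Subgroup.closure (S : Set G) = ⊤)
    (h4 : FourPoint (AssociatedSpace D) 0) (hX : HasInterpolation (AssociatedSpace D))
    (hstraight : ∀ n, IsStraight (ι n)) (hι : ∀ n, IsEquivariant (ρ n) (ι n)) {x : ∀ n, H n}
    (hx : ∀ n, IsApproximateCenter (ρ n) S (x n)) (hιx : ∀ n, ι n (vertex 1) = x n)
    {σ : G →* (AssociatedSpace D ≃ᵢ AssociatedSpace D)} (hσ : IsCoveredBy D σ) :
    ∃ g, 0 < lengthFunction σ g := by
  by_contra! hneg
  have hzero (g : G) : translationLength (σ g) = 0 :=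
    le_antisymm (hneg g) (translationLength_nonneg _)
  set o := toAssociated D (vertex 1) with ho
  have hmoved : ∃ α ∈ S, σ α o ≠ o := by
    by_contra! hfix
    have hstab (g : G) : σ g o = o := by
      obtain ⟨C, -, hC⟩ := exists_dist_le_mul_maxDisplacement hS (fun _ : ℕ => σ) (fun _ => o) g
      have hr : maxDisplacement σ S o = 0 :=
        le_antisymm (maxDisplacement_le σ o le_rfl fun α hα => by rw [hfix α hα, dist_self])
          (maxDisplacement_nonneg σ S o)
      have e := hC 0
      rw [hr, mul_zero] at e
      exact (dist_le_zero.1 e).symm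
    have hvert (a : G) : toAssociated D (vertex a) = o := by
      rw [← hstab a, hσ, smul_vertex, mul_one]
    have hall (p : CompleteGraph G) : toAssociated D p = o := by
      obtain ⟨a, b, t, rfl⟩ := p.exists_eq_edgePoint
      have e := hD.isStraight hstraight a b t
      rw [hvert, hvert, dist_self, mul_zero] at e
      exact (dist_eq_zero.1 e).symm
    obtain ⟨p, q, hpq⟩ := hD.nonzero
    exact hpq ((toAssociated_eq_iff D).1 ((hall p).trans (hall q).symm))
  obtain ⟨α₁, hα₁, hα₁'⟩ := hmoved
  obtain ⟨α₀, hα₀, hmax⟩ := S.exists_max_image (fun α => dist o (σ α o)) ⟨α₁, hα₁⟩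
  have hpos : 0 < dist o (σ α₀ o) := (dist_pos.2 (Ne.symm hα₁')).trans_le (hmax α₁ hα₁)
  obtain ⟨y, hy⟩ := h4.exists_displacement_lt hX σ hzero S o hpos hmax
  obtain ⟨q, rfl⟩ := toAssociated_surjective D y
  have hev : ∀ᶠ n in atTop, ∀ α ∈ S, lam n * (dist (ι (φ n) q) (ι (φ n) (α • q)) + 1) <
      lam n * dist (ι (φ n) (vertex 1)) (ι (φ n) (α₀ • vertex 1)) := by
    refine (Filter.eventually_all_finset S).2 fun α hα => ?_
    have e := hy α hα
    rw [hσ, ho, hσ, dist_toAssociated, dist_toAssociated] at e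
    have T := (hD.tendsto_dist q (α • q)).add hD.tendsto_zero
    rw [add_zero] at T
    filter_upwards [T.eventually_lt (hD.tendsto_dist _ _) e] with n hn
    linarith
  obtain ⟨n, hn⟩ := hev.exists
  have hc := hx (φ n) (ι (φ n) q)
  have hb := dist_le_maxDisplacement (ρ (φ n)) (x (φ n)) hα₀
  have hne : Nonempty S := ⟨⟨α₀, hα₀⟩⟩
  obtain ⟨α, hα⟩ := exists_eq_ciSup_of_finite
    (f := fun α : S => dist (ι (φ n) q) (ρ (φ n) α (ι (φ n) q)))
  have hlt := lt_of_mul_lt_mul_left (hn α α.2) (hD.pos n).le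
  rw [hι, hι, hιx] at hlt
  change _ = maxDisplacement _ _ _ at hα
  linarith

/-- Pointwise convergence of rescaled length functions implies convergence of their projective
classes. -/
theorem tendstoPLF_of_tendsto_mul {G : Type*} {L : ℕ → G → ℝ} {L' : G → ℝ} {lam : ℕ → ℝ}
    (hlam : ∀ n, 0 < lam n)
    (hL : ∀ g, Tendsto (fun n => lam n * L n g) atTop (𝓝 (L' g))) (h' : L' ≠ 0) :
    TendstoPLF L L' := by
  obtain ⟨g, hg⟩ := Function.ne_iff.1 h'
  obtain ⟨N, hN⟩ := eventually_atTop.1 ((hL g).eventually_ne hg)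
  have hne (n : ℕ) : L (n + N) ≠ 0 := fun e =>
    hN (n + N) (Nat.le_add_left _ _) (by rw [e]; simp)
  have hne' (n : ℕ) : lam (n + N) • L (n + N) ≠ 0 := smul_ne_zero (hlam _).ne' (hne n)
  refine ⟨h', N, hne, ?_⟩
  have hmk (n : ℕ) : PLF.mk (L (n + N)) (hne n) = PLF.mk (lam (n + N) • L (n + N)) (hne' n) :=
    ((Projectivization.mk_eq_mk_iff' ℝ _ _ _ _).2 ⟨lam (n + N), rfl⟩).symm
  simp only [hmk]
  have hcont : Continuous fun v : {v : G → ℝ // v ≠ 0} => PLF.mk v.1 v.2 :=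
    continuous_quotient_mk' (s := projectivizationSetoid ℝ (G → ℝ))
  have hvec : Tendsto (fun n => (⟨lam (n + N) • L (n + N), hne' n⟩ : {v : G → ℝ // v ≠ 0})) atTop
      (𝓝 ⟨L', h'⟩) :=
    tendsto_subtype_rng.2 (tendsto_pi_nhds.2 fun g => (hL g).comp (tendsto_add_atTop_nat N))
  exact (hcont.tendsto _).comp hvec

end LimitTree

end RTreeLimit

theorem mainTheorem3 {G : Type*} [Group G] (S : Finset G)
    (hS : Subgroup.closure (S : Set G) = ⊤)
    (Δ : ℝ) (hΔ : 0 < Δ)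
    (H : ℕ → Type*) [∀ n, MetricSpace (H n)]
    (hgeod : ∀ n, IsGeodesicSpace (H n)) (hthin : ∀ n, HasThinTriangles (H n) Δ)
    (ρ : ∀ n, G →* (H n ≃ᵢ H n)) (hρ : BlowsUp ρ)
    (x : ∀ n, H n) (hx : ∀ n, IsApproximateCenter (ρ n) S (x n))
    (ι : ∀ n, CompleteGraph G → H n)
    (hstraight : ∀ n, IsStraight (ι n)) (hequiv : ∀ n, IsEquivariant (ρ n) (ι n))
    (hι : ∀ n g, ι n (CompleteGraph.vertex g) = ρ n g (x n)) :
    (∃ (φ : ℕ → ℕ) (lam : ℕ → ℝ) (D : PseudoMetricSpace (CompleteGraph G)),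
      IsRescaledLimit ι φ lam D) ∧
    ∀ (φ : ℕ → ℕ) (lam : ℕ → ℝ) (D : PseudoMetricSpace (CompleteGraph G)),
      IsRescaledLimit ι φ lam D →
      IsRTree (AssociatedSpace D) ∧
      ∃ σ : G →* (AssociatedSpace D ≃ᵢ AssociatedSpace D),
        IsCoveredBy D σ ∧
        (∃ g : G, IsHyperbolic (σ g)) ∧
        TendstoPLF (fun n => lengthFunction (ρ (φ n))) (lengthFunction σ) ∧
        (IsIrreducibleAction σ → (∀ g : G, ∃ m : ℤ, lengthFunction σ g = m) →
          ∃ T : Set (AssociatedSpace D),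
            IsLeast {T' | IsInvariantSubtree σ T'} T ∧
            IsMetricSimplicialTree T ∧
            ∀ g : G, ⨅ y : T, dist (y : AssociatedSpace D) (σ g y) = lengthFunction σ g) := by
  have h (n : ℕ) : FourPoint (H n) (6 * Δ) :=
    fourPoint_of_hasThinTriangles hΔ.le (hgeod n) (hthin n)
  refine ⟨exists_isRescaledLimit hS h hρ hstraight hι, fun φ lam D hD => ?_⟩
  have h4 := hD.fourPoint h
  have hX := hD.hasInterpolation h4 hstraight
  obtain ⟨σ, hσ⟩ := exists_action_associated D (hD.dist_smul hequiv)
  obtain ⟨g, hg⟩ := hD.exists_lengthFunction_pos hS h4 hX hstraight hequiv hx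
    (fun n => by rw [hι, map_one]; rfl) hσ
  refine ⟨h4.isRTree hX, σ, hσ,
    ⟨g, h4.isHyperbolic hX hg (toAssociated D (CompleteGraph.vertex 1))⟩,
    tendstoPLF_of_tendsto_mul hD.pos (hD.tendsto_lengthFunction h
      (fun n => (hgeod n).hasInterpolation) h4 hX hequiv hσ)
      (fun e => hg.ne' (congrFun e g)), ?_⟩
  rintro ⟨a, b, ha, hb, hab⟩ hint
  obtain ⟨y, hy, hyint⟩ := h4.exists_integral_orbit hX hint ha hb hab
  have hT := h4.isInvariantSubtree_orbitHull hX σ y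
  exact ⟨orbitHull σ y, ⟨hT, fun T' hT' => h4.orbitHull_subset hX ha.1 hy hT'⟩,
    h4.isMetricSimplicialTree_orbitHull hX hyint, h4.iInf_dist_invariantSubtree hX hT⟩
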